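/- **Conventions.** A finite metric space $(X,d)$ with $|X|=n$ has rational distances, represented in binary as natural numbers over a common denominator; together with $k$ (in unary) this is an instance, and $|(X,d,k)|$ denotes the size of its representation. Throughout $1\le k\le n$. Algorithms are randomized and use a string of uniformly random bits whose length is a polynomial in the stated size parameter. **$k$-server.** Let $d\le 1$ on $X$. A configuration is $C\in X^k$; $d(C,C')$ is the minimum weight of a perfect matching between the $k$ locations of $C$ and the $k$ locations of $C'$. A request at $x\in X$ costs a configuration $C$ the loss $\ell_x(C)=0$ if $x\in C$ and $\ell_x(C)=2\min_{y\in C}d(y,x)$ otherwise. An online algorithm is given the instance and the time horizon $T\geq 1$; in round $t$ it is shown the request $x_t$ and chooses a configuration $C_t$ depending only on the instance, $T$, $x_1,\dots,x_t$ and its random bits. It is *efficient* if in each round $C_t$ is computed in time polynomial in $T$ and $|(X,d,k)|$. It has *regret* at most $R(n,T)$ if for every such instance, every $T\ge 1$ and every request sequence $x_1,\dots,x_T$ fixed in advance, $$\mathbb E\Big[\sum_{t=1}^T \ell_{x_t}(C_t)+\sum_{t=2}^T d(C_t,C_{t-1})\Big]\;\le\;\min_{C\in X^k}\sum_{t=1}^T\ell_{x_t}(C)+R(n,T).$$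 **$k$-median.** Given an instance $(X,d,k)$ (no bound on $d$), find $A\subseteq X$ with $|A|=k$ minimizing $\mathrm{VAL}(A)=\sum_{x\in X}\min_{a\in A}d(x,a)$; let $\mathrm{OPT}$ be the minimum. A polynomial-time $\rho$-approximation is a randomized algorithm that runs in time polynomial in $|(X,d,k)|$ and always outputs a set $A\subseteq X$ with $|A|=k$, such that $\mathbb E[\mathrm{VAL}(A)]\le\rho\cdot\mathrm{OPT}$ on every instance. **Theorem.** Suppose that for some $\mu>0$ and some polynomial $f$ there is an efficient online algorithm for the $k$-server problem with regret at most $f(n)\,T^{1-\mu}$. Then for every $\varepsilon>0$ there is a polynomial-time $(2+\varepsilon)$-approximation algorithm for the $k$-median problem. -/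

import Mathlib

noncomputable section

namespace KServer

/-! ### The machine model: structured programs over binary trees, with a step count

A program works on a store of variables `X 0, X 1, …` that hold finite binary trees; it reads its
input from `X 0` and leaves its output in `X 0`.  Writing a value costs one plus the size of the
whole value written, and testing a variable costs one.  Polynomial time in this model is the usual
polynomial time: a multi-tape Turing machine holds each of the finitely many variables of a program
on a tape of its own and simulates the program with polynomial overhead, and conversely
(a tape is two lists of symbols). -/

/-- Finite binary trees, the data on which programs operate. -/
inductive Data : Type
  | nil : Data
  | pair : Data → Data → Data

namespace Data

/-- The size of a tree: its number of nodes, leaves included. -/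
def size : Data → ℕ
  | nil => 1
  | pair a b => 1 + a.size + b.size

/-- The left subtree (the tree `nil` if there is none). -/
def fst : Data → Data
  | nil => nil
  | pair a _ => a

/-- The right subtree (the tree `nil` if there is none). -/
def snd : Data → Data
  | nil => nil
  | pair _ b => b

/-- A list of trees as a tree. -/
def ofList : List Data → Data
  | [] => nil
  | a :: l => pair a (ofList l)

/-- A bit as a tree. -/
def ofBool : Bool → Data
  | false => nil
  | true => pair nil nil

/-- A natural number in unary. -/
def ofUnary (m : ℕ) : Data := ofList (List.replicate m nil)

/-- A natural number in binary, least significant bit first. -/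
def ofBinary (m : ℕ) : Data := ofList (m.bits.map ofBool)

/-- A string of `m` bits. -/
def ofBits {m : ℕ} (r : Fin m → Bool) : Data := ofList (List.ofFn fun i => ofBool (r i))

/-- A list of points of the `n`-point space `Fin n`. -/
def ofPoints {n : ℕ} (l : List (Fin n)) : Data := ofList (l.map fun i => ofUnary i)

end Data

/-- The contents of the variables. -/
abbrev Store : Type := ℕ → Data

/-- Right-hand sides of assignments. -/
inductive Expr : Type
  | nil : Expr
  | var (x : ℕ) : Expr
  | pair (x y : ℕ) : Expr
  | fst (x : ℕ) : Expr
  | snd (x : ℕ) : Expr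

/-- The value of a right-hand side. -/
def Expr.eval (s : Store) : Expr → Data
  | .nil => .nil
  | .var x => s x
  | .pair x y => .pair (s x) (s y)
  | .fst x => (s x).fst
  | .snd x => (s x).snd

/-- Programs.  A test asks whether a variable is different from `nil`. -/
inductive Prog : Type
  | skip : Prog
  | assign (x : ℕ) (e : Expr) : Prog
  | seq (p q : Prog) : Prog
  | cond (x : ℕ) (p q : Prog) : Prog
  | loop (x : ℕ) (p : Prog) : Prog

/-- `Exec p s s' c`: started on the store `s`, the program `p` halts on the store `s'`, at cost `c`.
Here `cond x p q` is `if x ≠ nil then p else q`, and `loop x p` is `while x ≠ nil do p`. -/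
inductive Exec : Prog → Store → Store → ℕ → Prop
  | skip (s : Store) : Exec .skip s s 1
  | assign (x : ℕ) (e : Expr) (s : Store) :
      Exec (.assign x e) s (Function.update s x (e.eval s)) (1 + (e.eval s).size)
  | seq {p q : Prog} {s s' s'' : Store} {a b : ℕ} :
      Exec p s s' a → Exec q s' s'' b → Exec (.seq p q) s s'' (a + b)
  | condTrue {x : ℕ} {p q : Prog} {s s' : Store} {a : ℕ} :
      s x ≠ .nil → Exec p s s' a → Exec (.cond x p q) s s' (1 + a)
  | condFalse {x : ℕ} {p q : Prog} {s s' : Store} {a : ℕ} :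
      s x = .nil → Exec q s s' a → Exec (.cond x p q) s s' (1 + a)
  | loopDone {x : ℕ} {p : Prog} {s : Store} :
      s x = .nil → Exec (.loop x p) s s 1
  | loopStep {x : ℕ} {p : Prog} {s s' s'' : Store} {a b : ℕ} :
      s x ≠ .nil → Exec p s s' a → Exec (.loop x p) s' s'' b →
      Exec (.loop x p) s s'' (1 + a + b)

/-- The store at the start: the input is in variable `0`, every other variable is `nil`. -/
def initStore (input : Data) : Store := Function.update (fun _ => Data.nil) 0 input

/-- On the given input the program `p` halts at cost at most `t` with the given output. -/
def Prog.Outputs (p : Prog) (input output : Data) (t : ℕ) : Prop :=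
  ∃ (s : Store) (c : ℕ), Exec p (initStore input) s c ∧ c ≤ t ∧ s 0 = output

/-! ### Finite metric spaces with a bit representation -/

/-- A metric with rational values on the `n`-point space `Fin n`, given by its bit representation:
natural numbers `num i j` over a common denominator `den`. -/
structure RationalMetric (n : ℕ) where
  num : Fin n → Fin n → ℕ
  den : ℕ
  den_pos : 0 < den
  num_self : ∀ i, num i i = 0
  eq_of_num_eq_zero : ∀ i j, num i j = 0 → i = j
  symm : ∀ i j, num i j = num j i
  triangle : ∀ i j l, num i l ≤ num i j + num j l

namespace RationalMetric

variable {n : ℕ}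

/-- The distance function. -/
def dist (M : RationalMetric n) (i j : Fin n) : ℝ := (M.num i j : ℝ) / (M.den : ℝ)

/-- All distances are at most one, the standing normalisation of the `k`-server problem. -/
def DistLeOne (M : RationalMetric n) : Prop := ∀ i j, M.dist i j ≤ 1

/-- The instance consisting of the metric space and the number `k`: the numbers `n` and `k` (in
unary), the common denominator and the matrix of numerators (in binary). -/
def encode (M : RationalMetric n) (k : ℕ) : Data :=
  .ofList [.ofUnary n, .ofUnary k, .ofBinary M.den,
    .ofList (List.ofFn fun i => .ofList (List.ofFn fun j => .ofBinary (M.num i j)))]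

/-- The size of the representation of the instance. -/
def inputSize (M : RationalMetric n) (k : ℕ) : ℕ := (M.encode k).size

end RationalMetric

/-- The average of `g` over a uniformly random string of `m` bits. -/
def expect {m : ℕ} (g : (Fin m → Bool) → ℝ) : ℝ := (∑ r : Fin m → Bool, g r) / 2 ^ m

/-! ### The `k`-server problem -/

variable {n k : ℕ}

/-- The cost of a minimum weight matching between the configurations `C` and `C'`. -/
def matchDist (M : RationalMetric n) (C C' : Fin k → Fin n) : ℝ :=
  ⨅ σ : Equiv.Perm (Fin k), ∑ i, M.dist (C i) (C' (σ i))

open Classical in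
/-- The loss of the configuration `C` for a request at `x`: zero if there is a server at `x`, and
twice the distance from `x` to the nearest server otherwise. -/
def serverLoss (M : RationalMetric n) (x : Fin n) (C : Fin k → Fin n) : ℝ :=
  if x ∈ Set.range C then 0 else 2 * ⨅ i, M.dist (C i) x

/-- The cost of serving `T` requests `x 0, …, x (T - 1)`, with the configurations
`C 0, …, C (T - 1)` right after the requests; the first configuration is chosen for free. -/
def serverCost (M : RationalMetric n) (T : ℕ) (x : ℕ → Fin n) (C : ℕ → Fin k → Fin n) : ℝ :=
  ∑ t ∈ Finset.range T, serverLoss M (x t) (C t) +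
    ∑ t ∈ Finset.Ico 1 T, matchDist M (C t) (C (t - 1))

/-- The cost of the best fixed configuration of `k` servers in hindsight. -/
def bestStaticCost (M : RationalMetric n) (k T : ℕ) (x : ℕ → Fin n) : ℝ :=
  ⨅ C : Fin k → Fin n, ∑ t ∈ Finset.range T, serverLoss M (x t) C

/-- What an online algorithm knows when it answers a request: the instance, the time horizon, the
requests up to and including the current one, and its random bits. -/
def serverInput {m : ℕ} (M : RationalMetric n) (k T : ℕ) (past : List (Fin n))
    (r : Fin m → Bool) : Data :=
  .ofList [M.encode k, .ofUnary T, .ofPoints past, .ofBits r]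

/-- An efficient randomised online algorithm for the `k`-server problem (on metrics with distances
at most one and with `1 ≤ k ≤ n`): `config M k T r past` is the configuration it moves to after the
requests `past`, if `T` is the time horizon and `r` its string of random bits, the same string in
all rounds.  In each round the new configuration is computed in time polynomial in `T` and in the
size of the representation of the instance. -/
structure KServerAlgorithm where
  prog : Prog
  coins : Polynomial ℕ
  time : Polynomial ℕ
  config : ∀ {n : ℕ} [NeZero n] (M : RationalMetric n) (k T : ℕ),
    (Fin (coins.eval (M.inputSize k + T)) → Bool) → List (Fin n) → Fin k → Fin n
  computes : ∀ {n : ℕ} [NeZero n] (M : RationalMetric n) (k T : ℕ), M.DistLeOne → 1 ≤ k → k ≤ n →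
    ∀ (r : Fin (coins.eval (M.inputSize k + T)) → Bool) (past : List (Fin n)),
      past ≠ [] → past.length ≤ T →
      prog.Outputs (serverInput M k T past r) (.ofPoints (List.ofFn (config M k T r past)))
        (time.eval (M.inputSize k + T))

/-- The configuration of the algorithm in round `t` on the request sequence `x`, which depends only
on the requests `x 0, …, x t`. -/
def KServerAlgorithm.configAt (A : KServerAlgorithm) [NeZero n] (M : RationalMetric n) (k T : ℕ)
    (r : Fin (A.coins.eval (M.inputSize k + T)) → Bool) (x : ℕ → Fin n) (t : ℕ) : Fin k → Fin n :=
  A.config M k T r ((List.range (t + 1)).map x)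

/-- The algorithm has regret at most `R n T` on `n`-point spaces and time horizon `T`, against every
request sequence fixed in advance. -/
def KServerAlgorithm.HasRegret (A : KServerAlgorithm) (R : ℕ → ℕ → ℝ) : Prop :=
  ∀ (n : ℕ) [NeZero n] (M : RationalMetric n) (k T : ℕ), M.DistLeOne → 1 ≤ k → k ≤ n → 1 ≤ T →
    ∀ x : ℕ → Fin n,
      expect (fun r => serverCost M T x (A.configAt M k T r x)) ≤ bestStaticCost M k T x + R n T

/-! ### The `k`-median problem -/

/-- The value of a set `A` of centres: the sum of the distances of all points to `A`. -/
def medianVal (M : RationalMetric n) (A : Finset (Fin n)) : ℝ :=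
  ∑ x : Fin n, ⨅ a : A, M.dist x a

/-- The minimal value of a set of exactly `k` centres. -/
def medianOpt (M : RationalMetric n) (k : ℕ) : ℝ :=
  ⨅ A : {A : Finset (Fin n) // A.card = k}, medianVal M A.1

/-- A randomised polynomial-time algorithm for the `k`-median problem (`1 ≤ k ≤ n`): with the random
bits `r` it outputs the set `sol M k r` of exactly `k` centres, listed without repetition. -/
structure KMedianAlgorithm where
  prog : Prog
  coins : Polynomial ℕ
  time : Polynomial ℕ
  sol : ∀ {n : ℕ} (M : RationalMetric n) (k : ℕ),
    (Fin (coins.eval (M.inputSize k)) → Bool) → Finset (Fin n)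
  computes : ∀ {n : ℕ} (M : RationalMetric n) (k : ℕ), 1 ≤ k → k ≤ n →
    ∀ r : Fin (coins.eval (M.inputSize k)) → Bool,
      (sol M k r).card = k ∧
      ∃ l : List (Fin n), l.Nodup ∧ l.toFinset = sol M k r ∧
        prog.Outputs (.ofList [M.encode k, .ofBits r]) (.ofPoints l) (time.eval (M.inputSize k))

/-- The expected value of the output is at most `ρ` times the optimum, on every instance. -/
def KMedianAlgorithm.IsApprox (B : KMedianAlgorithm) (ρ : ℝ) : Prop :=
  ∀ (n : ℕ) (M : RationalMetric n) (k : ℕ), 1 ≤ k → k ≤ n →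
    expect (fun r => medianVal M (B.sol M k r)) ≤ ρ * medianOpt M k

end KServer

end

/-! The farthest-point heuristic yields `k` centres and a scale, the largest distance `r` of a point
to them: `k + 1` points are at mutual distances at least `r`, so the optimum is at least `r / 2`.
Truncating the metric at a distance between `n * r` and `2 * n * r` and taking that distance as the
unit gives distances at most one, with an optimum of at least `1 / (4 * n)`.

Feed the online algorithm uniformly random requests. The configuration of a round is independent of
the next request, which is therefore, in expectation, at `1 / n` times the `k`-median value of the
configuration. By the triangle inequality this distance is at most the loss plus the movement cost
of the next round, whereas the losses of an optimal set of centres are twice its distances: this is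
the factor 2. Over a polynomially long horizon the regret is negligible compared with the optimum,
so the configuration of a uniformly random round is good in expectation. If it leaves a point at
distance at least the truncation bound, the greedy centres, of value at most that bound, are no
worse. -/

namespace KServer

namespace Data

theorem one_le_size (d : Data) : 1 ≤ d.size := by
  cases d <;> simp only [size] <;> omega

theorem size_fst_le (d : Data) : d.fst.size ≤ d.size := by
  cases d <;> simp only [fst, size] <;> omega

theorem size_snd_le (d : Data) : d.snd.size ≤ d.size := by
  cases d <;> simp only [snd, size] <;> omega

end Data

/-! ### Running a program inside a larger one -/

/-- A number above all variables of the expression. -/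
def Expr.bound : Expr → ℕ
  | .nil => 0
  | .var x => x + 1
  | .pair x y => max (x + 1) (y + 1)
  | .fst x => x + 1
  | .snd x => x + 1

/-- A number above all variables of the program: from there on, variables are free for other
uses. -/
def Prog.bound : Prog → ℕ
  | .skip => 0
  | .assign x e => max (x + 1) e.bound
  | .seq p q => max p.bound q.bound
  | .cond x p q => max (x + 1) (max p.bound q.bound)
  | .loop x p => max (x + 1) p.bound

theorem Expr.eval_update_of_bound_le {e : Expr} {y : ℕ} (h : e.bound ≤ y) (s : Store) (d : Data) :
    e.eval (Function.update s y d) = e.eval s := by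
  cases e <;> simp only [Expr.bound, max_le_iff, Nat.succ_le_iff] at h <;> simp only [Expr.eval]
  case pair => rw [Function.update_of_ne h.1.ne, Function.update_of_ne h.2.ne]
  all_goals rw [Function.update_of_ne h.ne]

namespace Exec

theorem update_of_bound_le {p : Prog} {s s' : Store} {c : ℕ} (h : Exec p s s' c) {y : ℕ}
    (hy : p.bound ≤ y) (d : Data) :
    Exec p (Function.update s y d) (Function.update s' y d) c := by
  induction h with
  | skip s => exact .skip _
  | assign x e s =>
    simp only [Prog.bound, max_le_iff, Nat.succ_le_iff] at hy
    rw [Function.update_comm hy.1.ne, ← Expr.eval_update_of_bound_le hy.2 s d]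
    exact .assign ..
  | seq _ _ ih₁ ih₂ =>
    simp only [Prog.bound, max_le_iff] at hy
    exact .seq (ih₁ hy.1) (ih₂ hy.2)
  | condTrue hx _ ih =>
    simp only [Prog.bound, max_le_iff, Nat.succ_le_iff] at hy
    exact .condTrue (by rwa [Function.update_of_ne hy.1.ne]) (ih hy.2.1)
  | condFalse hx _ ih =>
    simp only [Prog.bound, max_le_iff, Nat.succ_le_iff] at hy
    exact .condFalse (by rwa [Function.update_of_ne hy.1.ne]) (ih hy.2.2)
  | loopDone hx =>
    simp only [Prog.bound, max_le_iff, Nat.succ_le_iff] at hy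
    exact .loopDone (by rwa [Function.update_of_ne hy.1.ne])
  | loopStep hx _ _ ih₁ ih₂ =>
    have hy' := hy
    simp only [Prog.bound, max_le_iff, Nat.succ_le_iff] at hy'
    exact .loopStep (by rwa [Function.update_of_ne hy'.1.ne]) (ih₁ hy'.2) (ih₂ hy)

theorem apply_eq_of_bound_le {p : Prog} {s s' : Store} {c : ℕ} (h : Exec p s s' c) {y : ℕ}
    (hy : p.bound ≤ y) : s' y = s y := by
  induction h with
  | skip s => rfl
  | assign x e s =>
    simp only [Prog.bound, max_le_iff, Nat.succ_le_iff] at hy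
    rw [Function.update_of_ne hy.1.ne']
  | seq _ _ ih₁ ih₂ =>
    simp only [Prog.bound, max_le_iff] at hy
    rw [ih₂ hy.2, ih₁ hy.1]
  | condTrue _ _ ih =>
    simp only [Prog.bound, max_le_iff] at hy
    exact ih hy.2.1
  | condFalse _ _ ih =>
    simp only [Prog.bound, max_le_iff] at hy
    exact ih hy.2.2
  | loopDone _ => rfl
  | loopStep _ _ _ ih₁ ih₂ => rw [ih₂ hy, ih₁ ((le_max_right _ _).trans hy)]

theorem size_apply_le {p : Prog} {s s' : Store} {c : ℕ} (h : Exec p s s' c) (x : ℕ) :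
    (s' x).size ≤ (s x).size + c := by
  induction h with
  | assign y e s =>
    rcases eq_or_ne x y with rfl | hx
    · rw [Function.update_self]; omega
    · rw [Function.update_of_ne hx]; omega
  | _ => omega

end Exec

@[simp] theorem initStore_zero (d : Data) : initStore d 0 = d := by simp [initStore]

theorem initStore_of_ne_zero (d : Data) {x : ℕ} (hx : x ≠ 0) : initStore d x = .nil := by
  simp [initStore, hx]

@[simp] theorem update_initStore_zero (d d' : Data) :
    Function.update (initStore d) 0 d' = initStore d' := by
  simp [initStore]

/-- Resets the variables `1, …, m` to `nil`. -/
def Prog.clear : ℕ → Prog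
  | 0 => .skip
  | m + 1 => .seq (.assign (m + 1) .nil) (Prog.clear m)

theorem Prog.exec_clear {m : ℕ} {s : Store} (hs : ∀ x, m < x → s x = .nil) :
    Exec (Prog.clear m) s (initStore (s 0)) (1 + 2 * m) := by
  induction m generalizing s with
  | zero =>
    have : s = initStore (s 0) := by
      funext x
      rcases eq_or_ne x 0 with rfl | hx
      · simp
      · rw [initStore_of_ne_zero _ hx, hs x (Nat.pos_of_ne_zero hx)]
    rw [← this]
    exact .skip s
  | succ m ih =>
    have hclear := ih (s := Function.update s (m + 1) .nil) fun x hx => by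
      rcases eq_or_ne x (m + 1) with rfl | hne
      · simp
      · rw [Function.update_of_ne hne, hs x (by omega)]
    rw [Function.update_of_ne (by simp)] at hclear
    have hrun := (Exec.assign (m + 1) .nil s).seq hclear
    rwa [show 1 + (Expr.nil.eval s).size + (1 + 2 * m) = 1 + 2 * (m + 1) by
      simp only [Expr.eval, Data.size]; ring] at hrun

theorem Prog.Outputs.exists_exec_clear {p : Prog} {a b : Data} {t : ℕ} (h : p.Outputs a b t) :
    ∃ c ≤ t + (1 + 2 * p.bound),
      Exec (.seq p (.clear p.bound)) (initStore a) (initStore b) c := by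
  obtain ⟨s, c, hs, hc, rfl⟩ := h
  refine ⟨c + (1 + 2 * p.bound), by omega, hs.seq (Prog.exec_clear fun x hx => ?_)⟩
  rw [hs.apply_eq_of_bound_le hx.le, initStore_of_ne_zero _ (by omega)]

/-- The store with `a` in variable `0`, and with `b` and `c` saved in the first two variables that a
program of bound at most `N` leaves alone. -/
def workStore (N : ℕ) (a b c : Data) : Store :=
  Function.update (Function.update (initStore a) (N + 1) b) (N + 2) c

section workStore

variable (N : ℕ) (a b c d : Data)

theorem workStore_zero : workStore N a b c 0 = a := by simp [workStore]

theorem workStore_fst : workStore N a b c (N + 1) = b := by simp [workStore]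

theorem workStore_snd : workStore N a b c (N + 2) = c := by simp [workStore]

theorem update_workStore_zero : Function.update (workStore N a b c) 0 d = workStore N d b c := by
  simp only [workStore]
  rw [Function.update_comm (show N + 2 ≠ 0 by simp), Function.update_comm (show N + 1 ≠ 0 by simp),
    update_initStore_zero]

theorem update_workStore_fst :
    Function.update (workStore N a b c) (N + 1) d = workStore N a d c := by
  rw [workStore, Function.update_comm (by simp), Function.update_idem, workStore]

theorem update_workStore_snd :
    Function.update (workStore N a b c) (N + 2) d = workStore N a b d := by
  rw [workStore, Function.update_idem, workStore]

theorem initStore_eq_workStore : initStore a = workStore N a .nil .nil := by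
  have hnil (x : ℕ) : Function.update (initStore a) (x + 1) .nil = initStore a :=
    Function.update_eq_self_iff.2 (initStore_of_ne_zero a x.succ_ne_zero).symm
  rw [workStore, hnil, hnil]

end workStore

theorem Exec.workStore {p : Prog} {a a' : Data} {t N : ℕ}
    (h : Exec p (initStore a) (initStore a') t) (hp : p.bound ≤ N) (b c : Data) :
    Exec p (workStore N a b c) (workStore N a' b c) t :=
  (h.update_of_bound_le (hp.trans (by omega)) b).update_of_bound_le (hp.trans (by omega)) c

theorem polynomial_eval_le_eval (q : Polynomial ℕ) {x y : ℕ} (h : x ≤ y) :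
    q.eval x ≤ q.eval y := by
  simp only [Polynomial.eval_eq_sum, Polynomial.sum]
  gcongr

/-- The quantity `f a` is bounded by a polynomial in the size of the representation `e a`. -/
def PolyBounded {α : Type*} (e : α → Data) (f : α → ℕ) : Prop :=
  ∃ q : Polynomial ℕ, ∀ a, f a ≤ q.eval (e a).size

namespace PolyBounded

variable {α β : Type*} {e g : α → Data} {f f' : α → ℕ}

theorem size (e : α → Data) : PolyBounded e fun a => (e a).size :=
  ⟨.X, fun _ => by simp⟩

theorem const (e : α → Data) (m : ℕ) : PolyBounded e fun _ => m :=
  ⟨.C m, fun _ => by simp⟩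

theorem add (h : PolyBounded e f) (h' : PolyBounded e f') : PolyBounded e fun a => f a + f' a := by
  obtain ⟨q, hq⟩ := h
  obtain ⟨q', hq'⟩ := h'
  exact ⟨q + q', fun a => by simpa using add_le_add (hq a) (hq' a)⟩

theorem mul (h : PolyBounded e f) (h' : PolyBounded e f') : PolyBounded e fun a => f a * f' a := by
  obtain ⟨q, hq⟩ := h
  obtain ⟨q', hq'⟩ := h'
  exact ⟨q * q', fun a => by simpa using Nat.mul_le_mul (hq a) (hq' a)⟩

theorem mono (h : PolyBounded e f) (hf : ∀ a, f' a ≤ f a) : PolyBounded e f' := by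
  obtain ⟨q, hq⟩ := h
  exact ⟨q, fun a => (hf a).trans (hq a)⟩

theorem eval (h : PolyBounded e f) (q : Polynomial ℕ) : PolyBounded e fun a => q.eval (f a) := by
  obtain ⟨q', hq'⟩ := h
  exact ⟨q.comp q', fun a => by
    simpa only [Polynomial.eval_comp] using polynomial_eval_le_eval q (hq' a)⟩

theorem trans (h : PolyBounded e fun a => (g a).size) (h' : PolyBounded g f) :
    PolyBounded e f := by
  obtain ⟨q, hq⟩ := h'
  exact (h.eval q).mono hq

end PolyBounded

/-- The representation `g a` is computable from the representation `e a` in polynomial time, by one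
program for all `a`. -/
def PolyTime {α : Type*} (e g : α → Data) : Prop :=
  ∃ (p : Prog) (q : Polynomial ℕ), ∀ a, p.Outputs (e a) (g a) (q.eval (e a).size)

namespace PolyTime

variable {α β : Type*} {e g g' h : α → Data}

theorem of_outputs (p : Prog) {t : α → ℕ} (ht : PolyBounded e t)
    (hp : ∀ a, p.Outputs (e a) (g a) (t a)) : PolyTime e g := by
  obtain ⟨q, hq⟩ := ht
  refine ⟨p, q, fun a => ?_⟩
  obtain ⟨s, c, hs, hc, h0⟩ := hp a
  exact ⟨s, c, hs, hc.trans (hq a), h0⟩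

/-- A program can be made to leave nothing but its output, which allows running it as a part of
another program. -/
theorem exists_exec (hg : PolyTime e g) : ∃ (p : Prog) (q : Polynomial ℕ), ∀ a,
    ∃ c ≤ q.eval (e a).size, Exec p (initStore (e a)) (initStore (g a)) c := by
  obtain ⟨p, q, hp⟩ := hg
  refine ⟨.seq p (.clear p.bound), q + .C (1 + 2 * p.bound), fun a => ?_⟩
  simpa using (hp a).exists_exec_clear

theorem of_eq (hg : PolyTime e g) (h : ∀ a, g' a = g a) : PolyTime e g' := by
  rwa [funext h]

theorem comap (hg : PolyTime e g) (φ : β → α) :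
    PolyTime (fun b => e (φ b)) fun b => g (φ b) := by
  obtain ⟨p, q, hp⟩ := hg
  exact ⟨p, q, fun b => hp (φ b)⟩

theorem polyBounded_size (hg : PolyTime e g) : PolyBounded e fun a => (g a).size := by
  obtain ⟨p, q, hp⟩ := hg
  refine ((PolyBounded.size e).add ((PolyBounded.size e).eval q)).mono fun a => ?_
  obtain ⟨s, c, hs, hc, h0⟩ := hp a
  have := hs.size_apply_le 0
  rw [h0, initStore_zero] at this
  omega

theorem refl (e : α → Data) : PolyTime e e :=
  of_outputs .skip (.const e 1) fun _ => ⟨_, 1, .skip _, le_rfl, initStore_zero _⟩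

theorem trans (hg : PolyTime e g) (hh : PolyTime g h) : PolyTime e h := by
  have hsize := hg.polyBounded_size
  obtain ⟨p, q, hp⟩ := hg.exists_exec
  obtain ⟨p', q', hp'⟩ := hh.exists_exec
  refine of_outputs (.seq p p') (((PolyBounded.size e).eval q).add (hsize.eval q')) fun a => ?_
  obtain ⟨c, hc, hrun⟩ := hp a
  obtain ⟨c', hc', hrun'⟩ := hp' a
  exact ⟨_, c + c', hrun.seq hrun', add_le_add hc hc', initStore_zero _⟩

theorem of_expr (x : Expr) (hg : ∀ a, x.eval (initStore (e a)) = g a)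
    (hsize : PolyBounded e fun a => (g a).size) : PolyTime e g :=
  of_outputs (.assign 0 x) ((PolyBounded.const e 1).add hsize) fun a =>
    ⟨_, _, .assign 0 x _, by rw [hg], by rw [Function.update_self, hg]⟩

theorem nil : PolyTime e fun _ => .nil :=
  of_expr .nil (fun _ => rfl) (.const e 1)

theorem fst (hg : PolyTime e g) : PolyTime e fun a => (g a).fst :=
  hg.trans (of_expr (.fst 0) (fun _ => rfl) ((PolyBounded.size g).mono fun a => (g a).size_fst_le))

theorem snd (hg : PolyTime e g) : PolyTime e fun a => (g a).snd :=
  hg.trans (of_expr (.snd 0) (fun _ => rfl) ((PolyBounded.size g).mono fun a => (g a).size_snd_le))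

theorem pair (hg : PolyTime e g) (hh : PolyTime e h) : PolyTime e fun a => .pair (g a) (h a) := by
  have size_g := hg.polyBounded_size
  have size_h := hh.polyBounded_size
  obtain ⟨p, q, hp⟩ := hg.exists_exec
  obtain ⟨p', q', hp'⟩ := hh.exists_exec
  set N := max p.bound p'.bound
  have size_e := PolyBounded.size e
  refine of_outputs (.seq (.assign (N + 1) (.var 0)) (.seq p (.seq (.assign (N + 2) (.var 0))
    (.seq (.assign 0 (.var (N + 1))) (.seq p' (.assign 0 (.pair (N + 2) 0)))))))
    (((((size_e.eval q).add (size_e.eval q')).add size_e).add (size_g.add size_h)).mul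
      (.const e 4)) fun a => ?_
  obtain ⟨c, hc, hrun⟩ := hp a
  obtain ⟨c', hc', hrun'⟩ := hp' a
  have save_input := Exec.assign (N + 1) (.var 0) (workStore N (e a) .nil .nil)
  have save_result := Exec.assign (N + 2) (.var 0) (workStore N (g a) (e a) .nil)
  have load_input := Exec.assign 0 (.var (N + 1)) (workStore N (g a) (e a) (g a))
  have join := Exec.assign 0 (.pair (N + 2) 0) (workStore N (h a) (e a) (g a))
  simp only [Expr.eval, workStore_zero, workStore_fst, workStore_snd, update_workStore_zero,
    update_workStore_fst, update_workStore_snd] at save_input save_result load_input join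
  have total := save_input.seq ((hrun.workStore (le_max_left ..) _ _).seq (save_result.seq
    (load_input.seq ((hrun'.workStore (le_max_right ..) _ _).seq join))))
  rw [← initStore_eq_workStore] at total
  refine ⟨_, _, total, ?_, workStore_zero ..⟩
  have := (e a).one_le_size
  have := (g a).one_le_size
  have := (h a).one_le_size
  simp only [Data.size]
  omega

theorem ite {c : α → Data} [∀ a, Decidable (c a = .nil)] (hc : PolyTime e c) (hg : PolyTime e g)
    (hh : PolyTime e h) : PolyTime e fun a => if c a = .nil then g a else h a := by
  refine (hc.pair (hg.pair hh)).trans ?_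
  refine of_outputs (.seq (.assign 1 (.fst 0)) (.seq (.assign 0 (.snd 0))
    (.cond 1 (.assign 0 (.snd 0)) (.assign 0 (.fst 0))))) ((PolyBounded.size _).mul (.const _ 4))
    fun a => ?_
  have load_test := Exec.assign 1 (.fst 0) (workStore 0 (.pair (c a) (.pair (g a) (h a))) .nil .nil)
  have load_values := Exec.assign 0 (.snd 0)
    (workStore 0 (.pair (c a) (.pair (g a) (h a))) (c a) .nil)
  have choose_fst := Exec.assign 0 (.fst 0) (workStore 0 (.pair (g a) (h a)) (c a) .nil)
  have choose_snd := Exec.assign 0 (.snd 0) (workStore 0 (.pair (g a) (h a)) (c a) .nil)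
  have test_eq : workStore 0 (.pair (g a) (h a)) (c a) .nil 1 = c a := workStore_fst 0 ..
  have set_test (x y z d : Data) : Function.update (workStore 0 x y z) 1 d = workStore 0 x d z :=
    update_workStore_fst 0 ..
  simp only [Expr.eval, Data.fst, Data.snd, workStore_zero, update_workStore_zero, set_test]
    at load_test load_values choose_fst choose_snd
  have := (c a).one_le_size
  have := (g a).one_le_size
  have := (h a).one_le_size
  by_cases hnil : c a = .nil
  · have total := load_test.seq (load_values.seq
      (Exec.condFalse (p := .assign 0 (.snd 0)) (by rwa [test_eq]) choose_fst))
    rw [← initStore_eq_workStore] at total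
    refine ⟨_, _, total, ?_, by rw [workStore_zero, if_pos hnil]⟩
    simp only [Data.size]
    omega
  · have total := load_test.seq (load_values.seq
      (Exec.condTrue (q := .assign 0 (.fst 0)) (by rwa [test_eq]) choose_snd))
    rw [← initStore_eq_workStore] at total
    refine ⟨_, _, total, ?_, by rw [workStore_zero, if_neg hnil]⟩
    simp only [Data.size]
    omega

end PolyTime

theorem Exec.loop_workStore {p : Prog} {N m : ℕ} (hp : p.bound ≤ N) {s : ℕ → Data} {c : ℕ → ℕ}
    (hstep : ∀ i < m, Exec p (initStore (s i)) (initStore (s (i + 1))) (c i))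
    (hne : ∀ i < m, (s i).fst ≠ .nil) (hend : (s m).fst = .nil) :
    Exec (.loop (N + 1) (.seq p (.assign (N + 1) (.fst 0))))
      (KServer.workStore N (s 0) (s 0).fst .nil) (KServer.workStore N (s m) .nil .nil)
      (1 + ∑ i ∈ Finset.range m, (2 + c i + (s (i + 1)).fst.size)) := by
  induction m generalizing s c with
  | zero =>
    rw [hend]
    exact .loopDone (workStore_fst ..)
  | succ m ih =>
    have reload := Exec.assign (N + 1) (.fst 0) (KServer.workStore N (s 1) (s 0).fst .nil)
    simp only [Expr.eval, workStore_zero, update_workStore_fst] at reload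
    have first := ((hstep 0 m.succ_pos).workStore hp _ _).seq reload
    have rest := ih (s := fun i => s (i + 1)) (fun i hi => hstep (i + 1) (by omega))
      (fun i hi => hne (i + 1) (by omega)) hend
    have hrun := Exec.loopStep (by rw [workStore_fst]; exact hne 0 m.succ_pos) first rest
    convert hrun using 1
    rw [Finset.sum_range_succ']
    ring

namespace PolyTime

variable {α : Type*}

/-- The left subtree of the state serves as the loop condition; the states are indexed by the round
as well, so that the step need only be correct on states that do occur. -/
theorem iterate_while {s : α → ℕ → Data} {m b : α → ℕ}
    (hstep : PolyTime (fun x : Σ a, Fin (m a) => s x.1 x.2) fun x => s x.1 (x.2 + 1))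
    (hne : ∀ a, ∀ i < m a, (s a i).fst ≠ .nil) (hend : ∀ a, (s a (m a)).fst = .nil)
    (hm : PolyBounded (fun a => s a 0) m) (hb : PolyBounded (fun a => s a 0) b)
    (hsize : ∀ a, ∀ i ≤ m a, (s a i).size ≤ b a) :
    PolyTime (fun a => s a 0) fun a => s a (m a) := by
  obtain ⟨p, q, hp⟩ := hstep.exists_exec
  set N := p.bound
  refine of_outputs (.seq (.assign (N + 1) (.fst 0)) (.loop (N + 1) (.seq p
    (.assign (N + 1) (.fst 0))))) (((PolyBounded.const _ 1).add (.size _)).add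
      ((PolyBounded.const _ 1).add (hm.mul (((PolyBounded.const _ 2).add (hb.eval q)).add hb))))
    fun a => ?_
  choose c hc hrun using fun i : Fin (m a) => hp ⟨a, i⟩
  have loop := Exec.loop_workStore (c := fun i => if hi : i < m a then c ⟨i, hi⟩ else 0)
    (le_refl N) (fun i hi => by simpa only [dif_pos hi] using hrun ⟨i, hi⟩) (hne a) (hend a)
  have init := Exec.assign (N + 1) (.fst 0) (workStore N (s a 0) .nil .nil)
  simp only [Expr.eval, workStore_zero, update_workStore_fst] at init
  have total := init.seq loop
  rw [← initStore_eq_workStore] at total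
  refine ⟨_, _, total, ?_, workStore_zero ..⟩
  have round_cost : ∀ i ∈ Finset.range (m a), 2 + (if hi : i < m a then c ⟨i, hi⟩ else 0) +
      (s a (i + 1)).fst.size ≤ 2 + q.eval (b a) + b a := fun i hi => by
    have hi := Finset.mem_range.1 hi
    rw [dif_pos hi]
    have := (hc ⟨i, hi⟩).trans (polynomial_eval_le_eval q (hsize a i hi.le))
    have := (s a (i + 1)).size_fst_le.trans (hsize a (i + 1) hi)
    omega
  have := (s a 0).size_fst_le
  have := Finset.sum_le_card_nsmul _ _ _ round_cost
  rw [Finset.card_range, smul_eq_mul] at this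
  omega

end PolyTime

/-! ### Lists, Booleans and unary numbers -/

namespace Data

variable {α β : Type*}

/-- The representation of a pair by the representations of its components. -/
abbrev prod (e : α → Data) (f : β → Data) (x : α × β) : Data := .pair (e x.1) (f x.2)

/-- The representation of a list by the representations of its elements. -/
abbrev list (e : α → Data) (l : List α) : Data := .ofList (l.map e)

theorem size_ofList (l : List Data) : (ofList l).size = 1 + (l.map fun d => 1 + d.size).sum := by
  induction l with
  | nil => rfl
  | cons a l ih => simp only [ofList, size, List.map_cons, List.sum_cons, ih]; omega

theorem size_ofList_append (l l' : List Data) :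
    (ofList (l ++ l')).size + 1 = (ofList l).size + (ofList l').size := by
  simp only [size_ofList, List.map_append, List.sum_append]
  omega

theorem size_ofList_reverse (l : List Data) : (ofList l.reverse).size = (ofList l).size := by
  simp only [size_ofList, List.map_reverse, List.sum_reverse]

theorem size_ofList_le_of_sublist {l l' : List Data} (h : l.Sublist l') :
    (ofList l).size ≤ (ofList l').size := by
  simp only [size_ofList]
  have := (h.map fun d => 1 + d.size).sum_le_sum fun _ _ => Nat.zero_le _
  omega

theorem length_le_size_list (e : α → Data) (l : List α) : l.length ≤ (list e l).size := by
  have := List.length_le_sum_of_one_le ((l.map e).map fun d => 1 + d.size) (by simp)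
  rw [List.length_map, List.length_map] at this
  rw [list, size_ofList]
  omega

theorem size_le_size_list_of_mem {e : α → Data} {l : List α} {x : α} (h : x ∈ l) :
    (e x).size ≤ (list e l).size := by
  have := List.single_le_sum (l := (l.map e).map fun d => 1 + d.size) (by simp) _
    (List.mem_map_of_mem (List.mem_map_of_mem h))
  rw [list, size_ofList]
  omega

theorem size_list_le_of_sublist {e : α → Data} {l l' : List α} (h : l.Sublist l') :
    (list e l).size ≤ (list e l').size :=
  size_ofList_le_of_sublist (h.map e)

theorem size_ofList_le {l : List Data} {b : ℕ} (h : ∀ d ∈ l, d.size ≤ b) :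
    (ofList l).size ≤ 1 + l.length * (1 + b) := by
  rw [size_ofList]
  have := List.sum_le_card_nsmul (l.map fun d => 1 + d.size) (1 + b) (by simpa using h)
  simp only [List.length_map, smul_eq_mul] at this
  omega

theorem size_ofUnary (m : ℕ) : (ofUnary m).size = 1 + 2 * m := by
  simp only [ofUnary, size_ofList, List.map_replicate, List.sum_replicate, size, smul_eq_mul]
  omega

theorem ofUnary_eq_nil_iff {m : ℕ} : ofUnary m = .nil ↔ m = 0 := by
  cases m <;> simp [ofUnary, ofList, List.replicate_succ]

theorem snd_ofUnary (m : ℕ) : (ofUnary m).snd = .ofUnary (m - 1) := by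
  cases m <;> rfl

theorem iterate_snd_ofList (l : List Data) (i : ℕ) : snd^[i] (ofList l) = ofList (l.drop i) := by
  induction l generalizing i with
  | nil => rw [List.drop_nil, ofList, Function.iterate_fixed (show snd .nil = .nil from rfl)]
  | cons d l ih =>
    cases i with
    | zero => rfl
    | succ i => exact ih i

end Data

namespace PolyTime

variable {α β γ δ : Type*} {e g h : α → Data} {f : β → Data}

theorem const (d : Data) : PolyTime e fun _ => d := by
  induction d with
  | nil => exact nil
  | pair a b iha ihb => exact iha.pair ihb

theorem comp₂ {e' : γ → Data} {g : α × β → Data} {φ : γ → α} {ψ : γ → β}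
    (hg : PolyTime (Data.prod e f) g) (hφ : PolyTime e' fun c => e (φ c))
    (hψ : PolyTime e' fun c => f (ψ c)) : PolyTime e' fun c => g (φ c, ψ c) :=
  (hφ.pair hψ).trans (hg.comap fun c => (φ c, ψ c))

theorem comp₃ {e' : δ → Data} {f' : γ → Data} {g : α × β × γ → Data} {φ : δ → α} {ψ : δ → β}
    {χ : δ → γ} (hg : PolyTime (Data.prod e (Data.prod f f')) g)
    (hφ : PolyTime e' fun d => e (φ d)) (hψ : PolyTime e' fun d => f (ψ d))
    (hχ : PolyTime e' fun d => f' (χ d)) : PolyTime e' fun d => g (φ d, ψ d, χ d) :=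
  (hφ.pair (hψ.pair hχ)).trans (hg.comap fun d => (φ d, ψ d, χ d))

theorem comp_fst (hg : PolyTime e g) : PolyTime (Data.prod e f) fun x => g x.1 :=
  (refl (Data.prod e f)).fst.trans (hg.comap Prod.fst)

theorem foldl {eb : β → Data} {ec : γ → Data} {init : α → β} {l : α → List γ}
    {step : α → β → γ → β} {b : α → ℕ} (hinit : PolyTime e fun a => eb (init a))
    (hl : PolyTime e fun a => Data.list ec (l a))
    (hstep : PolyTime (Data.prod e (Data.prod eb ec)) fun x => eb (step x.1 x.2.1 x.2.2))
    (hb : PolyBounded e b)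
    (hsize : ∀ a, ∀ l', l' <+: l a → (eb (l'.foldl (step a) (init a))).size ≤ b a) :
    PolyTime e fun a => eb ((l a).foldl (step a) (init a)) := by
  let state (a : α) (i : ℕ) : Data := .pair (Data.list ec ((l a).drop i))
    (.pair (e a) (eb (((l a).take i).foldl (step a) (init a))))
  have state_zero : PolyTime e fun a => state a 0 := hl.pair ((refl e).pair hinit)
  have le_state_zero (a : α) : (e a).size ≤ (state a 0).size := by
    simp only [state, Data.size]
    omega
  have of_e {f : α → ℕ} (hf : PolyBounded e f) : PolyBounded (fun a => state a 0) f :=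
    ((PolyBounded.size _).mono le_state_zero).trans hf
  have state_eq (x : Σ a, Fin (l a).length) : (state x.1 x.2).fst =
      .pair (ec (l x.1)[x.2]) (Data.list ec ((l x.1).drop (x.2 + 1))) := by
    simp only [state, Data.fst, List.drop_eq_getElem_cons x.2.2]
    rfl
  have source := refl fun x : Σ a, Fin (l a).length => state x.1 x.2
  have run : PolyTime (fun a => state a 0) fun a => state a (l a).length := by
    refine iterate_while (b := fun a => 1 + (Data.list ec (l a)).size + (1 + (e a).size + b a))
      ?_ (fun a i hi => ?_) (fun a => ?_)
      (of_e (hl.polyBounded_size.mono fun a => Data.length_le_size_list ..))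
      (of_e (((PolyBounded.const _ 1).add hl.polyBounded_size).add
        (((PolyBounded.const _ 1).add (.size _)).add hb))) fun a i _ => ?_
    · refine (source.fst.snd.of_eq fun x => by rw [state_eq]; rfl).pair (source.snd.fst.pair
        ((hstep.comp₃ (φ := fun x => x.1) (ψ := fun x => ((l x.1).take x.2).foldl (step x.1) _)
          (χ := fun x => (l x.1)[x.2]) source.snd.fst source.snd.snd
          (source.fst.fst.of_eq fun x => by rw [state_eq]; rfl)).of_eq fun x => ?_))
      rw [List.take_succ_eq_append_getElem x.2.2, List.foldl_concat]
      rfl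
    · rw [state_eq ⟨a, i, hi⟩]
      exact Data.noConfusion
    · simp [state, Data.fst, Data.list, Data.ofList]
    · have := Data.size_list_le_of_sublist (e := ec) ((l a).drop_sublist i)
      have := hsize a _ ((l a).take_prefix i)
      simp only [state, Data.size]
      omega
  exact (state_zero.trans run).snd.snd.of_eq fun a => by simp [state, Data.snd]

theorem reverse {ec : γ → Data} {l : α → List γ} (hl : PolyTime e fun a => Data.list ec (l a)) :
    PolyTime e fun a => Data.list ec (l a).reverse := by
  refine (foldl (eb := Data.list ec) (init := fun _ => []) (step := fun _ l c => c :: l) nil hl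
    ((refl _).snd.snd.pair (refl _).snd.fst) hl.polyBounded_size fun a l' hl' => ?_).of_eq
    fun a => ?_
  · rw [List.foldl_flip_cons_eq_append', List.append_nil, Data.list, List.map_reverse,
      Data.size_ofList_reverse]
    exact Data.size_list_le_of_sublist hl'.sublist
  · rw [List.foldl_flip_cons_eq_append', List.append_nil]

theorem foldr {eb : β → Data} {ec : γ → Data} {init : α → β} {l : α → List γ}
    {step : α → γ → β → β} {b : α → ℕ} (hinit : PolyTime e fun a => eb (init a))
    (hl : PolyTime e fun a => Data.list ec (l a))
    (hstep : PolyTime (Data.prod e (Data.prod ec eb)) fun x => eb (step x.1 x.2.1 x.2.2))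
    (hb : PolyBounded e b)
    (hsize : ∀ a, ∀ l', l' <:+ l a → (eb (l'.foldr (step a) (init a))).size ≤ b a) :
    PolyTime e fun a => eb ((l a).foldr (step a) (init a)) := by
  have source := refl (Data.prod e (Data.prod eb ec))
  refine (foldl (step := fun a y c => step a c y) hinit hl.reverse
    (hstep.comp₃ (φ := fun x : α × β × γ => x.1) (ψ := fun x => x.2.2) (χ := fun x => x.2.1)
      source.fst source.snd.snd source.snd.fst) hb
    fun a l' hl' => ?_).of_eq fun a => by rw [List.foldl_reverse]
  have := hsize a l'.reverse (List.reverse_prefix.1 (by rwa [List.reverse_reverse]))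
  rwa [List.foldr_reverse] at this

theorem map {ec : γ → Data} {l : α → List γ} {eb : β → Data} {v : α → γ → β}
    (hl : PolyTime e fun a => Data.list ec (l a))
    (hv : PolyTime (Data.prod e ec) fun x => eb (v x.1 x.2)) :
    PolyTime e fun a => Data.list eb ((l a).map (v a)) := by
  have source := refl (Data.prod e (Data.prod ec (Data.list eb)))
  obtain ⟨q, hq⟩ := hv.polyBounded_size
  have elem_bound := (((PolyBounded.const _ 1).add (.size e)).add hl.polyBounded_size).eval q
  refine (foldr (eb := Data.list eb) (init := fun _ => []) (step := fun a c l' => v a c :: l') nil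
    hl ((hv.comp₂ source.fst source.snd.fst).pair source.snd.snd)
    ((PolyBounded.const _ 1).add (hl.polyBounded_size.mul ((PolyBounded.const _ 1).add
      elem_bound))) fun a l' hl' => ?_).of_eq fun a => by rw [List.map_eq_foldr]
  rw [← List.map_eq_foldr]
  refine (Data.size_ofList_le (b := q.eval (1 + (e a).size + (Data.list ec (l a)).size)) ?_).trans
    ?_
  · simp only [List.mem_map, forall_exists_index, and_imp, forall_apply_eq_imp_iff₂]
    intro c hc
    refine (hq (a, c)).trans (polynomial_eval_le_eval q ?_)
    have := Data.size_le_size_list_of_mem (e := ec) (hl'.mem hc)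
    simp only [Data.size]
    omega
  · rw [List.length_map, List.length_map]
    gcongr
    exact hl'.length_le.trans (Data.length_le_size_list ec _)

theorem cond {c : α → Bool} (hc : PolyTime e fun a => .ofBool (c a)) (hg : PolyTime e g)
    (hh : PolyTime e h) : PolyTime e fun a => if c a then g a else h a := by
  classical
  exact (ite hc hh hg).of_eq fun a => by cases c a <;> simp [Data.ofBool]

theorem not {c : α → Bool} (hc : PolyTime e fun a => .ofBool (c a)) :
    PolyTime e fun a => .ofBool (!c a) :=
  (cond hc (const (.ofBool false)) (const (.ofBool true))).of_eq fun a => by cases c a <;> rfl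

theorem or {c c' : α → Bool} (hc : PolyTime e fun a => .ofBool (c a))
    (hc' : PolyTime e fun a => .ofBool (c' a)) : PolyTime e fun a => .ofBool (c a || c' a) :=
  (cond hc (const (.ofBool true)) hc').of_eq fun a => by cases c a <;> rfl

theorem filter {ec : γ → Data} {l : α → List γ} {c : α → γ → Bool}
    (hl : PolyTime e fun a => Data.list ec (l a))
    (hc : PolyTime (Data.prod e ec) fun x => .ofBool (c x.1 x.2)) :
    PolyTime e fun a => Data.list ec ((l a).filter (c a)) := by
  have source := refl (Data.prod e (Data.prod ec (Data.list ec)))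
  refine (foldr (eb := Data.list ec) (init := fun _ => [])
    (step := fun a x l' => bif c a x then x :: l' else l') nil hl
    ((cond (hc.comp₂ source.fst source.snd.fst) source.snd source.snd.snd).of_eq fun x => ?_)
    hl.polyBounded_size fun a l' hl' => ?_).of_eq fun a => by rw [List.filter_eq_foldr]
  · cases c x.1 x.2.1 <;> rfl
  · rw [← List.filter_eq_foldr]
    exact Data.size_list_le_of_sublist (List.filter_sublist.trans hl'.sublist)

theorem append {ec : γ → Data} {l l' : α → List γ} (hl : PolyTime e fun a => Data.list ec (l a))
    (hl' : PolyTime e fun a => Data.list ec (l' a)) :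
    PolyTime e fun a => Data.list ec (l a ++ l' a) := by
  refine (foldr (eb := Data.list ec) (init := l') (step := fun _ c l => c :: l) hl' hl
    (refl _).snd (hl.polyBounded_size.add hl'.polyBounded_size) fun a l₀ hl₀ => ?_).of_eq
    fun a => by rw [List.foldr_cons_eq_append']
  have := Data.size_ofList_append (l₀.map ec) ((l' a).map ec)
  have := Data.size_list_le_of_sublist (e := ec) hl₀.sublist
  rw [List.foldr_cons_eq_append']
  simp only [Data.list, List.map_append] at this ⊢
  omega

theorem iterate {eb : β → Data} {m : α → ℕ} {init : α → β} {step : α → β → β} {b : α → ℕ}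
    (hm : PolyTime e fun a => .ofUnary (m a)) (hinit : PolyTime e fun a => eb (init a))
    (hstep : PolyTime (Data.prod e eb) fun x => eb (step x.1 x.2)) (hb : PolyBounded e b)
    (hsize : ∀ a, ∀ i ≤ m a, (eb ((step a)^[i] (init a))).size ≤ b a) :
    PolyTime e fun a => eb ((step a)^[m a] (init a)) := by
  have source := refl (Data.prod e (Data.prod (fun _ : Unit => Data.nil) eb))
  refine (foldr (ec := fun _ : Unit => Data.nil) (l := fun a => List.replicate (m a) ())
    (step := fun a _ y => step a y) hinit (hm.of_eq fun a => by simp [Data.list, Data.ofUnary])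
    (hstep.comp₂ (φ := fun x => x.1) source.fst source.snd.snd) hb
    fun a l' hl' => ?_).of_eq fun a => by rw [List.foldr_const, List.length_replicate]
  rw [List.foldr_const]
  exact hsize a _ (by simpa using hl'.length_le)

theorem drop {ec : γ → Data} {l : α → List γ} {m : α → ℕ}
    (hl : PolyTime e fun a => Data.list ec (l a)) (hm : PolyTime e fun a => .ofUnary (m a)) :
    PolyTime e fun a => Data.list ec ((l a).drop (m a)) := by
  refine (iterate (eb := id) (step := fun _ => Data.snd) hm hl (refl _).snd.snd
    hl.polyBounded_size fun a i _ => ?_).of_eq fun a => ?_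
  · rw [Data.list, Data.iterate_snd_ofList]
    exact Data.size_ofList_le_of_sublist (List.drop_sublist ..)
  · rw [Data.list, Data.iterate_snd_ofList, List.map_drop, id]

theorem getD {ec : γ → Data} {l : α → List γ} {m : α → ℕ} {c : γ} (hc : ec c = .nil)
    (hl : PolyTime e fun a => Data.list ec (l a)) (hm : PolyTime e fun a => .ofUnary (m a)) :
    PolyTime e fun a => ec ((l a).getD (m a) c) := by
  have fst_ofList (l' : List γ) : (Data.list ec l').fst = ec (l'.getD 0 c) := by
    cases l' with
    | nil => exact hc.symm
    | cons => rfl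
  refine (drop hl hm).fst.of_eq fun a => ?_
  rw [fst_ofList, List.getD_eq_getElem?_getD, List.getD_eq_getElem?_getD, List.getElem?_drop,
    add_zero]

variable {α γ : Type*} {e g : α → Data} {m k : α → ℕ}

theorem ofUnary_succ (hm : PolyTime e fun a => .ofUnary (m a)) :
    PolyTime e fun a => .ofUnary (m a + 1) :=
  nil.pair hm

theorem ofUnary_pred (hm : PolyTime e fun a => .ofUnary (m a)) :
    PolyTime e fun a => .ofUnary (m a - 1) :=
  hm.snd.of_eq fun _ => (Data.snd_ofUnary _).symm

theorem polyBounded_ofUnary (hm : PolyTime e fun a => .ofUnary (m a)) : PolyBounded e m :=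
  hm.polyBounded_size.mono fun a => by rw [Data.size_ofUnary]; omega

theorem ofUnary_add (hm : PolyTime e fun a => .ofUnary (m a))
    (hk : PolyTime e fun a => .ofUnary (k a)) : PolyTime e fun a => .ofUnary (m a + k a) := by
  refine (iterate (eb := Data.ofUnary) (step := fun _ => Nat.succ) hk hm
    (ofUnary_succ (refl _).snd) ((PolyBounded.const _ 1).add ((PolyBounded.const _ 2).mul
      (hm.polyBounded_ofUnary.add hk.polyBounded_ofUnary))) fun a i hi => ?_).of_eq fun a => ?_
  · rw [Nat.succ_iterate, Data.size_ofUnary]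
    omega
  · rw [Nat.succ_iterate]

theorem ofUnary_sub (hm : PolyTime e fun a => .ofUnary (m a))
    (hk : PolyTime e fun a => .ofUnary (k a)) : PolyTime e fun a => .ofUnary (m a - k a) := by
  refine (iterate (eb := Data.ofUnary) (step := fun _ => Nat.pred) hk hm
    (ofUnary_pred (refl _).snd) hm.polyBounded_size fun a i _ => ?_).of_eq fun a => ?_
  · rw [Nat.pred_iterate, Data.size_ofUnary, Data.size_ofUnary]
    omega
  · rw [Nat.pred_iterate]

theorem ofUnary_mul (hm : PolyTime e fun a => .ofUnary (m a))
    (hk : PolyTime e fun a => .ofUnary (k a)) : PolyTime e fun a => .ofUnary (m a * k a) := by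
  refine (iterate (eb := Data.ofUnary) (init := fun _ => 0) (step := fun a y => y + m a) hk nil
    (ofUnary_add (refl _).snd hm.comp_fst) ((PolyBounded.const _ 1).add
      ((PolyBounded.const _ 2).mul (hk.polyBounded_ofUnary.mul hm.polyBounded_ofUnary)))
    fun a i hi => ?_).of_eq fun a => ?_
  · simp only [add_right_iterate, Data.size_ofUnary, zero_add, smul_eq_mul]
    gcongr
  · simp only [add_right_iterate, zero_add, smul_eq_mul, mul_comm]

theorem ofUnary_eval (hm : PolyTime e fun a => .ofUnary (m a)) (q : Polynomial ℕ) :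
    PolyTime e fun a => .ofUnary (q.eval (m a)) := by
  induction q using Polynomial.induction_on' with
  | add p q hp hq => simpa only [Polynomial.eval_add] using ofUnary_add hp hq
  | monomial n c =>
    simp only [Polynomial.eval_monomial]
    refine ofUnary_mul (const (.ofUnary c)) ?_
    induction n with
    | zero => exact const (.ofUnary 1)
    | succ n ih => exact ofUnary_mul ih hm

theorem decide_pos (hm : PolyTime e fun a => .ofUnary (m a)) :
    PolyTime e fun a => .ofBool (decide (0 < m a)) := by
  classical
  refine (ite hm (const (.ofBool false)) (const (.ofBool true))).of_eq fun a => ?_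
  rcases Nat.eq_zero_or_pos (m a) with hzero | hpos
  · simp [Data.ofUnary_eq_nil_iff, hzero]
  · simp [Data.ofUnary_eq_nil_iff, hpos, hpos.ne']

theorem decide_lt (hm : PolyTime e fun a => .ofUnary (m a))
    (hk : PolyTime e fun a => .ofUnary (k a)) :
    PolyTime e fun a => .ofBool (decide (m a < k a)) :=
  (decide_pos (ofUnary_sub hk hm)).of_eq fun a => by simp

theorem decide_eq (hm : PolyTime e fun a => .ofUnary (m a))
    (hk : PolyTime e fun a => .ofUnary (k a)) :
    PolyTime e fun a => .ofBool (decide (m a = k a)) :=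
  (not (or (decide_lt hm hk) (decide_lt hk hm))).of_eq fun a => by
    congr 1
    rw [Bool.eq_iff_iff]
    simp only [Bool.not_eq_true', Bool.or_eq_false_iff, decide_eq_false_iff_not, decide_eq_true_iff]
    omega

theorem list_range (hm : PolyTime e fun a => .ofUnary (m a)) :
    PolyTime e fun a => Data.list Data.ofUnary (List.range (m a)) := by
  have countdown (i : ℕ) : (fun x : ℕ × List ℕ => (x.1 + 1, x.1 :: x.2))^[i] (0, []) =
      (i, (List.range i).reverse) := by
    induction i with
    | zero => rfl
    | succ i ih => simp [Function.iterate_succ_apply', ih, List.range_succ]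
  have one := PolyBounded.const e 1
  have bound_m := one.add ((PolyBounded.const e 2).mul hm.polyBounded_ofUnary)
  have source := refl (Data.prod e (Data.prod Data.ofUnary (Data.list Data.ofUnary)))
  have run := iterate (e := e) (eb := Data.prod Data.ofUnary (Data.list Data.ofUnary))
    (init := fun _ => (0, [])) (step := fun _ x => (x.1 + 1, x.1 :: x.2)) hm
    (const (.pair .nil .nil)) ((ofUnary_succ source.snd.fst).pair source.snd)
    ((one.add bound_m).add (one.add (hm.polyBounded_ofUnary.mul (one.add bound_m))))
    fun a i hi => by
      rw [countdown]
      have elem_size : ∀ d ∈ (List.range i).map Data.ofUnary, d.size ≤ 1 + 2 * m a := by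
        simp only [List.mem_map, List.mem_range, forall_exists_index, and_imp,
          forall_apply_eq_imp_iff₂, Data.size_ofUnary]
        omega
      have list_size := Data.size_ofList_le elem_size
      have := Nat.mul_le_mul_right (1 + (1 + 2 * m a)) hi
      rw [List.length_map, List.length_range] at list_size
      simp only [Data.list, Data.size, Data.size_ofUnary, List.map_reverse,
        Data.size_ofList_reverse]
      omega
  refine (reverse (ec := Data.ofUnary) (l := fun a => (List.range (m a)).reverse)
    (run.snd.of_eq fun a => ?_)).of_eq fun a => ?_
  · rw [countdown]
    rfl
  · rw [List.reverse_reverse]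

theorem length {ec : γ → Data} {l : α → List γ} (hl : PolyTime e fun a => Data.list ec (l a)) :
    PolyTime e fun a => .ofUnary (l a).length :=
  (map (eb := fun _ : Unit => Data.nil) (v := fun _ _ => ()) hl nil).of_eq fun a => by
    simp [Data.ofUnary, Data.list]

theorem any {ec : γ → Data} {l : α → List γ} {c : α → γ → Bool}
    (hl : PolyTime e fun a => Data.list ec (l a))
    (hc : PolyTime (Data.prod e ec) fun x => .ofBool (c x.1 x.2)) :
    PolyTime e fun a => .ofBool ((l a).any (c a)) :=
  (decide_pos (length (filter hl hc))).of_eq fun a => by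
    rw [Bool.eq_iff_iff.2 (by simp [List.length_pos_iff_exists_mem] :
      (l a).any (c a) ↔ decide (0 < ((l a).filter (c a)).length) = true)]

theorem all {ec : γ → Data} {l : α → List γ} {c : α → γ → Bool}
    (hl : PolyTime e fun a => Data.list ec (l a))
    (hc : PolyTime (Data.prod e ec) fun x => .ofBool (c x.1 x.2)) :
    PolyTime e fun a => .ofBool ((l a).all (c a)) :=
  (not (any (c := fun a x => !c a x) hl (not hc))).of_eq fun a => by
    rw [List.all_eq_not_any_not]

end PolyTime

/-- One step of a traversal of a forest, kept as a list of trees still to be visited: the root of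
the first tree is removed. -/
def Data.visit : List Data → List Data
  | [] => []
  | .nil :: l => l
  | .pair d d' :: l => d :: d' :: l

theorem Data.sum_size_visit (l : List Data) :
    ((Data.visit l).map Data.size).sum = (l.map Data.size).sum - 1 := by
  rcases l with _ | ⟨_ | _, l⟩
  · rfl
  · simp [Data.visit, Data.size]
  · simp only [Data.visit, Data.size, List.map_cons, List.sum_cons]
    omega

theorem Data.sum_size_iterate_visit (l : List Data) (i : ℕ) :
    ((Data.visit^[i] l).map Data.size).sum = (l.map Data.size).sum - i := by
  induction i with
  | zero => rfl
  | succ i ih =>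
    rw [Function.iterate_succ_apply', Data.sum_size_visit, ih]
    omega

theorem Data.ofList_eq_nil_iff_sum_size {l : List Data} :
    Data.ofList l = .nil ↔ (l.map Data.size).sum = 0 := by
  rcases l with _ | ⟨d, l⟩
  · simp [Data.ofList]
  · have := d.one_le_size
    simp only [Data.ofList, List.map_cons, List.sum_cons, reduceCtorEq, false_iff]
    omega

theorem Data.size_ofList_le_sum_size (l : List Data) :
    (Data.ofList l).size ≤ 1 + 2 * (l.map Data.size).sum := by
  induction l with
  | nil => simp [Data.ofList, Data.size]
  | cons d l ih =>
    have := d.one_le_size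
    simp only [Data.ofList, Data.size, List.map_cons, List.sum_cons]
    omega

namespace PolyTime

variable {α : Type*} {e g : α → Data}

theorem visit {l : α → List Data} (hl : PolyTime e fun a => .ofList (l a)) :
    PolyTime e fun a => .ofList (Data.visit (l a)) := by
  classical
  refine (ite hl.fst hl.snd (hl.fst.fst.pair (hl.fst.snd.pair hl.snd))).of_eq fun a => ?_
  rcases l a with _ | ⟨_ | _, l⟩ <;> simp [Data.visit, Data.ofList, Data.fst, Data.snd]

theorem ofUnary_size (hg : PolyTime e g) : PolyTime e fun a => .ofUnary (g a).size := by
  let state (a : α) (i : ℕ) : Data := .pair (.ofList (Data.visit^[i] [g a])) (.ofUnary i)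
  have sum_size (a : α) (i : ℕ) :
      ((Data.visit^[i] [g a]).map Data.size).sum = (g a).size - i := by
    rw [Data.sum_size_iterate_visit]
    simp
  have state_zero : PolyTime e fun a => state a 0 := (hg.pair nil).pair nil
  have size_state_zero : PolyBounded (fun a => state a 0) fun a => (g a).size :=
    (PolyBounded.size _).mono fun a => by
      simp only [state, Function.iterate_zero_apply, Data.ofList, Data.size]
      omega
  have source := refl fun x : Σ a, Fin (g a).size => state x.1 x.2
  refine (state_zero.trans (iterate_while (m := fun a => (g a).size) ((visit source.fst).pair
    (ofUnary_succ source.snd) |>.of_eq fun x => ?_) (fun a i hi => ?_) (fun a => ?_)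
    size_state_zero ((PolyBounded.const _ 3).add ((PolyBounded.const _ 4).mul size_state_zero))
    fun a i hi => ?_)).snd
  · simp only [state, Function.iterate_succ_apply']
  · rw [ne_eq, Data.fst, Data.ofList_eq_nil_iff_sum_size, sum_size]
    omega
  · rw [Data.fst, Data.ofList_eq_nil_iff_sum_size, sum_size, Nat.sub_self]
  · have := Data.size_ofList_le_sum_size (Data.visit^[i] [g a])
    rw [sum_size] at this
    simp only [state, Data.size, Data.size_ofUnary]
    omega

end PolyTime

namespace Data

theorem snd_ofBinary (x : ℕ) : (ofBinary x).snd = .ofBinary (x / 2) := by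
  rcases Nat.even_or_odd' x with ⟨y, rfl | rfl⟩
  · rcases Nat.eq_zero_or_pos y with rfl | hy
    · rfl
    · rw [ofBinary, Nat.bit0_bits _ hy.ne', Nat.mul_div_cancel_left _ two_pos]
      rfl
  · rw [ofBinary, Nat.bit1_bits, show (2 * y + 1) / 2 = y by omega]
    rfl

theorem fst_ofBinary (x : ℕ) : (ofBinary x).fst = .ofBool (decide (x % 2 = 1)) := by
  rcases Nat.even_or_odd' x with ⟨y, rfl | rfl⟩
  · rcases Nat.eq_zero_or_pos y with rfl | hy
    · rfl
    · rw [ofBinary, Nat.bit0_bits _ hy.ne', Nat.mul_mod_right]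
      rfl
  · rw [ofBinary, Nat.bit1_bits, Nat.mul_add_mod]
    rfl

theorem ofBinary_two_mul {x : ℕ} (hx : x ≠ 0) : ofBinary (2 * x) = .pair .nil (.ofBinary x) := by
  rw [ofBinary, Nat.bit0_bits _ hx]
  rfl

theorem ofBinary_eq_nil_iff {x : ℕ} : ofBinary x = .nil ↔ x = 0 := by
  refine ⟨fun h => ?_, fun h => by simp [h, ofBinary, ofList]⟩
  rw [← Nat.size_eq_zero, ← Nat.size_eq_bits_len, List.length_eq_zero_iff]
  cases hx : x.bits with
  | nil => rfl
  | cons b l => simp [ofBinary, hx, ofList] at h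

theorem size_ofBinary_div_two_le (x : ℕ) : (ofBinary (x / 2)).size ≤ (ofBinary x).size := by
  rw [← snd_ofBinary]
  exact size_snd_le _

end Data

/-- One step of the comparison of two numbers `x` and `y` bit by bit, on states `(x, y, b)`: the
last bits are dropped, and `b` records whether the bits of `x` dropped so far represent a number
that is at most the one represented by those of `y`. -/
def leStep (s : ℕ × ℕ × Bool) : ℕ × ℕ × Bool :=
  (s.1 / 2, s.2.1 / 2,
    bif decide (s.1 % 2 = 1) then decide (s.2.1 % 2 = 1) && s.2.2
    else decide (s.2.1 % 2 = 1) || s.2.2)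

theorem leStep_iterate_snd_snd (i : ℕ) (s : ℕ × ℕ × Bool) (h : s.1 < 2 ^ i) (h' : s.2.1 < 2 ^ i) :
    (leStep^[i] s).2.2 = decide (s.1 < s.2.1 ∨ s.1 = s.2.1 ∧ s.2.2 = true) := by
  induction i generalizing s with
  | zero =>
    obtain ⟨x, y, b⟩ := s
    obtain rfl : x = 0 := by simpa using h
    obtain rfl : y = 0 := by simpa using h'
    simp
  | succ i ih =>
    obtain ⟨x, y, b⟩ := s
    rw [pow_succ] at h h'
    rw [Function.iterate_succ_apply, ih _ (Nat.div_lt_of_lt_mul (by linarith))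
      (Nat.div_lt_of_lt_mul (by linarith)), decide_eq_decide]
    simp only [leStep]
    rcases Nat.mod_two_eq_zero_or_one x with hx | hx <;>
      rcases Nat.mod_two_eq_zero_or_one y with hy | hy <;>
      cases b <;> simp [hx, hy] <;> omega

theorem size_ofBinary_leStep_iterate_le (i : ℕ) (s : ℕ × ℕ × Bool) :
    (Data.ofBinary (leStep^[i] s).1).size ≤ (Data.ofBinary s.1).size ∧
      (Data.ofBinary (leStep^[i] s).2.1).size ≤ (Data.ofBinary s.2.1).size := by
  induction i with
  | zero => exact ⟨le_rfl, le_rfl⟩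
  | succ i ih =>
    rw [Function.iterate_succ_apply']
    exact ⟨(Data.size_ofBinary_div_two_le _).trans ih.1,
      (Data.size_ofBinary_div_two_le _).trans ih.2⟩

namespace PolyTime

variable {α : Type*} {e : α → Data} {x y : α → ℕ}

theorem decide_ofBinary_pos (hx : PolyTime e fun a => .ofBinary (x a)) :
    PolyTime e fun a => .ofBool (decide (0 < x a)) := by
  classical
  refine (ite hx (const (.ofBool false)) (const (.ofBool true))).of_eq fun a => ?_
  rcases Nat.eq_zero_or_pos (x a) with hzero | hpos
  · simp [Data.ofBinary_eq_nil_iff, hzero]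
  · simp [Data.ofBinary_eq_nil_iff, hpos, hpos.ne']

theorem ofBinary_two_mul (hx : PolyTime e fun a => .ofBinary (x a)) :
    PolyTime e fun a => .ofBinary (2 * x a) :=
  (cond (decide_ofBinary_pos hx) (nil.pair hx) hx).of_eq fun a => by
    rcases Nat.eq_zero_or_pos (x a) with hzero | hpos
    · simp [hzero]
    · simp [hpos, Data.ofBinary_two_mul hpos.ne']

theorem ofBinary_div_two (hx : PolyTime e fun a => .ofBinary (x a)) :
    PolyTime e fun a => .ofBinary (x a / 2) :=
  hx.snd.of_eq fun _ => (Data.snd_ofBinary _).symm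

theorem decide_odd (hx : PolyTime e fun a => .ofBinary (x a)) :
    PolyTime e fun a => .ofBool (decide (x a % 2 = 1)) :=
  hx.fst.of_eq fun _ => (Data.fst_ofBinary _).symm

theorem leStep {b : α → Bool} (hx : PolyTime e fun a => .ofBinary (x a))
    (hy : PolyTime e fun a => .ofBinary (y a)) (hb : PolyTime e fun a => .ofBool (b a)) :
    PolyTime e fun a => Data.prod Data.ofBinary (Data.prod Data.ofBinary Data.ofBool)
      (KServer.leStep (x a, y a, b a)) := by
  refine ((ofBinary_div_two hx).pair ((ofBinary_div_two hy).pair (cond (decide_odd hx)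
    (cond (decide_odd hy) hb (const (.ofBool false)))
    (cond (decide_odd hy) (const (.ofBool true)) hb)))).of_eq fun a => ?_
  simp only [Data.prod, KServer.leStep]
  cases decide (x a % 2 = 1) <;> cases decide (y a % 2 = 1) <;> rfl

theorem decide_le_ofBinary (hx : PolyTime e fun a => .ofBinary (x a))
    (hy : PolyTime e fun a => .ofBinary (y a)) :
    PolyTime e fun a => .ofBool (decide (x a ≤ y a)) := by
  let eb := Data.prod Data.ofBinary (Data.prod Data.ofBinary Data.ofBool)
  have state := (refl (Data.prod e eb)).snd
  have run := iterate (step := fun _ => KServer.leStep) (init := fun a => (x a, y a, true))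
    (ofUnary_add (length (ec := Data.ofBool) hx) (length (ec := Data.ofBool) hy))
    (hx.pair (hy.pair (const (.ofBool true)))) (leStep state.fst state.snd.fst state.snd.snd)
    (((PolyBounded.const _ 1).add hx.polyBounded_size).add
      (((PolyBounded.const _ 1).add hy.polyBounded_size).add (PolyBounded.const _ 3)))
    fun a i _ => by
      have sizes := size_ofBinary_leStep_iterate_le i (x a, y a, true)
      have size_bit : (Data.ofBool (KServer.leStep^[i] (x a, y a, true)).2.2).size ≤ 3 := by
        cases (KServer.leStep^[i] (x a, y a, true)).2.2 <;> simp [Data.ofBool, Data.size]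
      simp only [Data.size] at sizes ⊢
      omega
  refine run.snd.snd.of_eq fun a => ?_
  have lt_two_pow {z m : ℕ} (h : z.bits.length ≤ m) : z < 2 ^ m :=
    (Nat.lt_size_self z).trans_le
      (Nat.pow_le_pow_right two_pos (z.size_eq_bits_len.symm.trans_le h))
  simp only [Data.prod, Data.snd]
  rw [leStep_iterate_snd_snd _ (x a, y a, true) (lt_two_pow (Nat.le_add_right _ _))
    (lt_two_pow (Nat.le_add_left _ _))]
  simp [le_iff_lt_or_eq]

theorem ofBinary_min (hx : PolyTime e fun a => .ofBinary (x a))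
    (hy : PolyTime e fun a => .ofBinary (y a)) : PolyTime e fun a => .ofBinary (min (x a) (y a)) :=
  (cond (decide_le_ofBinary hx hy) hx hy).of_eq fun a => by
    by_cases h : x a ≤ y a
    · simp [h]
    · simp [h, (not_le.1 h).le]

variable {α γ : Type*} {e : α → Data} {m N : α → ℕ}

theorem take {ec : γ → Data} {l : α → List γ} (hl : PolyTime e fun a => Data.list ec (l a))
    (hm : PolyTime e fun a => .ofUnary (m a)) :
    PolyTime e fun a => Data.list ec ((l a).take (m a)) :=
  (reverse (drop (reverse hl) (ofUnary_sub (length hl) hm))).of_eq fun a => by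
    rw [← List.reverse_take, List.reverse_reverse]

theorem ofUnary_mod (hm : PolyTime e fun a => .ofUnary (m a))
    (hN : PolyTime e fun a => .ofUnary (N a)) : PolyTime e fun a => .ofUnary (m a % N a) := by
  have iterate_eq (a : α) (i : ℕ) :
      (fun r => bif decide (r + 1 = N a) then 0 else r + 1)^[i] 0 = i % N a := by
    induction i with
    | zero => simp
    | succ i ih =>
      rw [Function.iterate_succ_apply', ih, ← Nat.mod_add_mod]
      by_cases h : i % N a + 1 = N a
      · simp [h]
      · rcases Nat.eq_zero_or_pos (N a) with h0 | hpos
        · simp [h0]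
        · have := Nat.mod_lt i hpos
          rw [Nat.mod_eq_of_lt (show i % N a + 1 < N a by omega)]
          simp [h]
  have source := refl (Data.prod e Data.ofUnary)
  refine (iterate (eb := Data.ofUnary) (init := fun _ => 0)
    (step := fun a r => bif decide (r + 1 = N a) then 0 else r + 1) hm nil
    ((cond (decide_eq (ofUnary_succ source.snd) hN.comp_fst) nil (ofUnary_succ source.snd)).of_eq
      fun x => by cases decide (x.2 + 1 = N x.1) <;> rfl)
    hm.polyBounded_size fun a i hi => ?_).of_eq fun a => by rw [iterate_eq]
  rw [iterate_eq, Data.size_ofUnary, Data.size_ofUnary]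
  have := Nat.mod_le i (N a)
  omega

end PolyTime

/-- The residue modulo `N` of the number with binary digits `l`, least significant digit first. It
turns random bits into an almost uniformly distributed number below `N`, and reducing in every step
keeps all intermediate values small enough to be written in unary. -/
def sample (N : ℕ) (l : List Bool) : ℕ :=
  l.foldr (fun b v => (b.toNat + 2 * v) % N) 0

theorem sample_lt {N : ℕ} (hN : 0 < N) (l : List Bool) : sample N l < N := by
  cases l with
  | nil => exact hN
  | cons b l => exact Nat.mod_lt _ hN

theorem PolyTime.sample {α : Type*} {e : α → Data} {N : α → ℕ} {l : α → List Bool}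
    (hpos : ∀ a, 0 < N a) (hN : PolyTime e fun a => .ofUnary (N a))
    (hl : PolyTime e fun a => Data.list Data.ofBool (l a)) :
    PolyTime e fun a => .ofUnary (KServer.sample (N a) (l a)) := by
  have source := refl (Data.prod e (Data.prod Data.ofBool Data.ofUnary))
  have digit : PolyTime (Data.prod e (Data.prod Data.ofBool Data.ofUnary))
      fun x => .ofUnary x.2.1.toNat :=
    (cond source.snd.fst (const (.ofUnary 1)) nil).of_eq fun x => by cases x.2.1 <;> rfl
  refine foldr (eb := Data.ofUnary) (init := fun _ => 0)
    (step := fun a b v => (b.toNat + 2 * v) % N a) nil hl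
    (ofUnary_mod (ofUnary_add digit (ofUnary_mul (const (.ofUnary 2)) source.snd.snd))
      hN.comp_fst) hN.polyBounded_size fun a l' _ => ?_
  have := sample_lt (hpos a) l'
  rw [KServer.sample] at this
  rw [Data.size_ofUnary, Data.size_ofUnary]
  omega

/-! ### Instances, greedy centres and the truncated metric -/

/-- The matrix of the numerators of the distances. -/
def RationalMetric.numMatrix {n : ℕ} (M : RationalMetric n) : List (List ℕ) :=
  List.ofFn fun i => List.ofFn fun j => M.num i j

theorem RationalMetric.encode_eq {n : ℕ} (M : RationalMetric n) (k : ℕ) :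
    M.encode k = .ofList [.ofUnary n, .ofUnary k, .ofBinary M.den,
      Data.list (Data.list Data.ofBinary) M.numMatrix] := by
  simp only [encode, numMatrix, Data.list, List.map_ofFn, Function.comp_def]

/-- An instance of the `k`-median problem. -/
structure KMedianInstance where
  n : ℕ
  k : ℕ
  metric : RationalMetric n
  one_le_k : 1 ≤ k
  k_le_n : k ≤ n

namespace KMedianInstance

variable (I : KMedianInstance)

/-- The representation of an instance as input of a program. -/
def enc : Data := I.metric.encode I.k

theorem n_pos : 0 < I.n := I.one_le_k.trans I.k_le_n

instance : NeZero I.n := ⟨I.n_pos.ne'⟩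

/-- The numerator of the distance of two points. Points are natural numbers here, so that lists of
points have the same type on all instances; the value is `0` for numbers that are not points. -/
def num (x y : ℕ) : ℕ := (I.metric.numMatrix.getD x []).getD y 0

theorem num_coe (x y : Fin I.n) : I.num x y = I.metric.num x y := by
  simp [num, RationalMetric.numMatrix]

/-- The numerator of the distance of a point to the nearest point in `0 :: A`. -/
def numTo (A : List ℕ) (x : ℕ) : ℕ := A.foldr (fun a m => min m (I.num x a)) (I.num x 0)

theorem exists_numTo_eq (A : List ℕ) (x : ℕ) : ∃ a ∈ 0 :: A, I.numTo A x = I.num x a := by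
  induction A with
  | nil => exact ⟨0, List.mem_singleton_self 0, rfl⟩
  | cons b A ih =>
    obtain ⟨a, ha, h⟩ := ih
    rw [numTo, List.foldr_cons, ← numTo, h]
    rcases le_total (I.num x a) (I.num x b) with hab | hba
    · exact ⟨a, by simp only [List.mem_cons] at ha ⊢; tauto, min_eq_left hab⟩
    · exact ⟨b, by simp, min_eq_right hba⟩

theorem numTo_le {A : List ℕ} {a : ℕ} (ha : a ∈ 0 :: A) (x : ℕ) : I.numTo A x ≤ I.num x a := by
  induction A with
  | nil => rw [List.mem_singleton.1 ha]; exact le_rfl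
  | cons b A ih =>
    rw [numTo, List.foldr_cons, ← numTo]
    simp only [List.mem_cons] at ha ih
    rcases ha with rfl | rfl | ha
    · exact (min_le_left _ _).trans (ih (.inl rfl))
    · exact min_le_right _ _
    · exact (min_le_left _ _).trans (ih (.inr ha))

/-- The element of `l` at the largest distance from `0 :: A`, or `0` if `l` is empty. -/
def farthestIn (A l : List ℕ) : ℕ :=
  l.foldr (fun x y => if I.numTo A y ≤ I.numTo A x then x else y) 0

theorem farthestIn_lt (A : List ℕ) {l : List ℕ} (hl : ∀ x ∈ l, x < I.n) :
    I.farthestIn A l < I.n := by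
  induction l with
  | nil => exact I.n_pos
  | cons x l ih =>
    rw [farthestIn, List.foldr_cons, ← farthestIn]
    simp only [List.forall_mem_cons] at hl
    split_ifs
    exacts [hl.1, ih hl.2]

theorem numTo_le_numTo_farthestIn (A : List ℕ) {l : List ℕ} {x : ℕ} (hx : x ∈ l) :
    I.numTo A x ≤ I.numTo A (I.farthestIn A l) := by
  induction l with
  | nil => simp at hx
  | cons y l ih =>
    rw [farthestIn, List.foldr_cons, ← farthestIn]
    rcases List.mem_cons.1 hx with rfl | hx
    · split_ifs with h
      exacts [le_rfl, (not_le.1 h).le]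
    · split_ifs with h
      exacts [(ih hx).trans h, ih hx]

/-- A point at the largest distance from `0 :: A`. -/
def farthest (A : List ℕ) : ℕ := I.farthestIn A (List.range I.n)

theorem farthest_lt (A : List ℕ) : I.farthest A < I.n :=
  I.farthestIn_lt A fun _ => List.mem_range.1

theorem numTo_le_numTo_farthest (A : List ℕ) {x : ℕ} (hx : x < I.n) :
    I.numTo A x ≤ I.numTo A (I.farthest A) :=
  I.numTo_le_numTo_farthestIn A (List.mem_range.2 hx)

/-- The points obtained from `0` by adding a farthest point `i` times. -/
def greedyList (i : ℕ) : List ℕ := (fun A => I.farthest A :: A)^[i] [0]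

theorem greedyList_succ (i : ℕ) :
    I.greedyList (i + 1) = I.farthest (I.greedyList i) :: I.greedyList i :=
  Function.iterate_succ_apply' ..

theorem length_greedyList (i : ℕ) : (I.greedyList i).length = i + 1 := by
  induction i with
  | zero => rfl
  | succ i ih => rw [greedyList_succ, List.length_cons, ih]

theorem zero_mem_greedyList (i : ℕ) : 0 ∈ I.greedyList i := by
  induction i with
  | zero => exact List.mem_singleton_self 0
  | succ i ih => rw [greedyList_succ]; exact List.mem_cons_of_mem _ ih

theorem lt_of_mem_greedyList {i x : ℕ} (hx : x ∈ I.greedyList i) : x < I.n := by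
  induction i with
  | zero => rw [List.mem_singleton.1 hx]; exact I.n_pos
  | succ i ih =>
    rw [greedyList_succ] at hx
    rcases List.mem_cons.1 hx with rfl | hx
    exacts [I.farthest_lt _, ih hx]

/-- The `k` centres chosen by the farthest-point heuristic. -/
def greedy : List ℕ := I.greedyList (I.k - 1)

theorem length_greedy : I.greedy.length = I.k := by
  rw [greedy, length_greedyList, Nat.sub_add_cancel I.one_le_k]

/-- The largest distance of a point to the greedy centres. -/
def radius : ℕ := I.numTo I.greedy (I.farthest I.greedy)

/-- The distance at which the metric is truncated. The factor of the radius lies between `n` and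
`2 * n`; it is a power of two so that it takes only doublings to compute. -/
def cap : ℕ := max 1 I.radius * 2 ^ Nat.clog 2 I.n

theorem cap_pos : 0 < I.cap := by
  unfold cap
  positivity

theorem n_mul_radius_le_cap : I.n * I.radius ≤ I.cap := by
  rw [cap, mul_comm]
  exact Nat.mul_le_mul (le_max_right _ _) (Nat.le_pow_clog one_lt_two _)

theorem two_pow_clog_le {n : ℕ} (hn : 0 < n) : 2 ^ Nat.clog 2 n ≤ 2 * n := by
  rcases (Nat.succ_le_iff.2 hn).eq_or_lt with rfl | hn
  · simp
  · have clog_pos := Nat.clog_pos one_lt_two hn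
    have := Nat.pow_pred_clog_lt_self one_lt_two hn
    rw [← Nat.succ_pred_eq_of_pos clog_pos, pow_succ]
    omega

theorem cap_le (h : 0 < I.radius) : I.cap ≤ 2 * I.n * I.radius := by
  rw [cap, max_eq_right h, mul_comm]
  exact Nat.mul_le_mul_right _ (two_pow_clog_le I.n_pos)

/-- The metric truncated at the distance `cap`, which becomes the unit of length. -/
def capped : RationalMetric I.n where
  num i j := min (I.metric.num i j) I.cap
  den := I.cap
  den_pos := I.cap_pos
  num_self i := by simp [I.metric.num_self]
  eq_of_num_eq_zero i j h := I.metric.eq_of_num_eq_zero i j (by have := I.cap_pos; omega)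
  symm i j := by rw [I.metric.symm]
  triangle i j l := by have := I.metric.triangle i j l; omega

theorem capped_distLeOne : I.capped.DistLeOne := fun i j =>
  div_le_one_of_le₀ (by exact_mod_cast min_le_right _ _) (Nat.cast_nonneg _)

/-- The configuration `C`, or the greedy centres if some point is at distance at least `cap` from
all of `C`. -/
def select (C : List ℕ) : List ℕ :=
  if ∃ x ∈ List.range I.n, ∀ a ∈ C, I.cap ≤ I.num x a then I.greedy else C

end KMedianInstance

/-- The points below `n` in `C`, followed by further points below `n` so as to obtain `k` points. -/
def fill (n k : ℕ) (C : List ℕ) : List ℕ :=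
  ((List.range n).filter (· ∈ C) ++ (List.range n).filter (· ∉ C)).take k

theorem exists_perm_range_fill_eq_take (n k : ℕ) (C : List ℕ) :
    ∃ l : List ℕ, l.Perm (List.range n) ∧ fill n k C = l.take k :=
  ⟨_, by simpa using List.filter_append_perm (fun x => decide (x ∈ C)) (List.range n), rfl⟩

theorem nodup_fill (n k : ℕ) (C : List ℕ) : (fill n k C).Nodup := by
  obtain ⟨l, hl, h⟩ := exists_perm_range_fill_eq_take n k C
  exact h ▸ (hl.nodup_iff.2 List.nodup_range).sublist (List.take_sublist _ _)

theorem length_fill {n k : ℕ} (hk : k ≤ n) (C : List ℕ) : (fill n k C).length = k := by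
  obtain ⟨l, hl, h⟩ := exists_perm_range_fill_eq_take n k C
  rw [h, List.length_take, hl.length_eq, List.length_range, min_eq_left hk]

theorem lt_of_mem_fill {n k x : ℕ} {C : List ℕ} (hx : x ∈ fill n k C) : x < n := by
  obtain ⟨l, hl, h⟩ := exists_perm_range_fill_eq_take n k C
  exact List.mem_range.1 (hl.subset (List.mem_of_mem_take (h ▸ hx)))

theorem subset_fill {n k : ℕ} {C : List ℕ} (hC : C.length ≤ k) (hlt : ∀ x ∈ C, x < n) :
    C ⊆ fill n k C := by
  intro x hx
  have sub : (List.range n).filter (· ∈ C) ⊆ C := fun y hy => by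
    simpa using (List.mem_filter.1 hy).2
  have length_le := ((List.nodup_range.filter _).subperm sub).length_le.trans hC
  rw [fill, List.take_append, List.take_of_length_le length_le]
  exact List.mem_append_left _ (List.mem_filter.2 ⟨List.mem_range.2 (hlt x hx), by simpa using hx⟩)

/-! ### The reduction takes polynomial time -/

namespace KMedianInstance

variable (I : KMedianInstance)

theorem size_ofBinary_num_le (x y : ℕ) : (Data.ofBinary (I.num x y)).size ≤ I.enc.size := by
  have size_getD_le {γ : Type} {ec : γ → Data} {c : γ} (hc : ec c = .nil) (l : List γ) (i : ℕ) :
      (ec (l.getD i c)).size ≤ (Data.list ec l).size := by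
    rcases lt_or_ge i l.length with h | h
    · rw [List.getD_eq_getElem _ _ h]
      exact Data.size_le_size_list_of_mem (List.getElem_mem h)
    · rw [List.getD_eq_default _ _ h, hc]
      exact Data.one_le_size _
  refine (size_getD_le rfl _ _).trans ((size_getD_le rfl _ _).trans ?_)
  rw [enc, RationalMetric.encode_eq]
  simp only [Data.ofList, Data.size]
  omega

theorem two_mul_n_lt_size_enc : 2 * I.n < I.enc.size := by
  rw [enc, RationalMetric.encode_eq]
  simp only [Data.ofList, Data.size, Data.size_ofUnary]
  omega

/-- One step of the doubling of a number `y` that stops as soon as the factor `p`, doubled along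
with it, reaches `n`. -/
def doubleStep (n : ℕ) (s : ℕ × ℕ) : ℕ × ℕ :=
  if s.1 < n then (2 * s.1, 2 * s.2) else s

theorem iterate_doubleStep (n y i : ℕ) : (doubleStep n)^[i] (1, y) =
    (2 ^ min i (Nat.clog 2 n), y * 2 ^ min i (Nat.clog 2 n)) := by
  induction i with
  | zero => simp
  | succ i ih =>
    rw [Function.iterate_succ_apply', ih, doubleStep]
    rcases lt_or_ge i (Nat.clog 2 n) with h | h
    · rw [min_eq_left h.le, min_eq_left (Nat.succ_le_of_lt h),
        if_pos ((Nat.lt_clog_iff_pow_lt one_lt_two).1 h), pow_succ]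
      ring_nf
    · rw [min_eq_right h, min_eq_right (h.trans i.le_succ),
        if_neg (Nat.le_pow_clog one_lt_two n).not_gt]

end KMedianInstance

theorem Data.size_ofBinary_mul_two_pow_le (x i : ℕ) :
    (Data.ofBinary (x * 2 ^ i)).size ≤ (Data.ofBinary x).size + 2 * i := by
  induction i with
  | zero => simp
  | succ i ih =>
    rw [pow_succ', mul_left_comm]
    rcases eq_or_ne (x * 2 ^ i) 0 with h | h
    · rw [h, mul_zero]
      rw [h] at ih
      omega
    · rw [Data.ofBinary_two_mul h]
      simp only [Data.size]
      omega

theorem Data.ofPoints_eq {n : ℕ} (l : List (Fin n)) :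
    Data.ofPoints l = Data.list Data.ofUnary (l.map (↑)) := by
  -- In `Data.ofPoints` the coercion to `ℕ` is applied to the whole list, as a monadic map.
  have : (do let a ← l; pure (a : ℕ)) = l.map (↑) := by simp [List.map_eq_flatMap]
  rw [Data.ofPoints, this]

namespace PolyTime

variable {α : Type*} {e : α → Data} {I : α → KMedianInstance}

theorem instance_n (hI : PolyTime e fun a => (I a).enc) : PolyTime e fun a => .ofUnary (I a).n :=
  hI.fst

theorem instance_k (hI : PolyTime e fun a => (I a).enc) : PolyTime e fun a => .ofUnary (I a).k :=
  hI.snd.fst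

theorem num (hI : PolyTime e fun a => (I a).enc) {x y : α → ℕ}
    (hx : PolyTime e fun a => .ofUnary (x a)) (hy : PolyTime e fun a => .ofUnary (y a)) :
    PolyTime e fun a => .ofBinary ((I a).num (x a) (y a)) := by
  have matrix : PolyTime e fun a => Data.list (Data.list Data.ofBinary) (I a).metric.numMatrix :=
    hI.snd.snd.snd.fst.of_eq fun a => by
      rw [KMedianInstance.enc, RationalMetric.encode_eq]
      rfl
  exact getD rfl (getD rfl matrix hx) hy

theorem numTo (hI : PolyTime e fun a => (I a).enc) {A : α → List ℕ} {x : α → ℕ}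
    (hA : PolyTime e fun a => Data.list Data.ofUnary (A a))
    (hx : PolyTime e fun a => .ofUnary (x a)) :
    PolyTime e fun a => .ofBinary ((I a).numTo (A a) (x a)) := by
  have source := refl (Data.prod e (Data.prod Data.ofUnary Data.ofBinary))
  refine foldr (eb := Data.ofBinary) (init := fun a => (I a).num (x a) 0)
    (step := fun a b m => min m ((I a).num (x a) b)) (num hI hx nil) hA
    (ofBinary_min source.snd.snd (num hI.comp_fst hx.comp_fst source.snd.fst))
    hI.polyBounded_size fun a l' _ => ?_
  obtain ⟨b, -, h⟩ := (I a).exists_numTo_eq l' (x a)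
  rw [KMedianInstance.numTo] at h
  rw [h]
  exact (I a).size_ofBinary_num_le _ _

theorem farthest (hI : PolyTime e fun a => (I a).enc) {A : α → List ℕ}
    (hA : PolyTime e fun a => Data.list Data.ofUnary (A a)) :
    PolyTime e fun a => .ofUnary ((I a).farthest (A a)) := by
  have source := refl (Data.prod e (Data.prod Data.ofUnary Data.ofUnary))
  refine foldr (eb := Data.ofUnary) (init := fun _ => 0)
    (step := fun a x y => if (I a).numTo (A a) y ≤ (I a).numTo (A a) x then x else y) nil
    (list_range (instance_n hI))
    ((cond (decide_le_ofBinary (numTo hI.comp_fst hA.comp_fst source.snd.snd)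
      (numTo hI.comp_fst hA.comp_fst source.snd.fst)) source.snd.fst source.snd.snd).of_eq
        fun x => ?_) hI.polyBounded_size fun a l' hl' => ?_
  · simp only [decide_eq_true_eq, apply_ite Data.ofUnary]
    rfl
  · have := (I a).farthestIn_lt (A a) fun x hx => List.mem_range.1 (hl'.subset hx)
    rw [KMedianInstance.farthestIn] at this
    rw [Data.size_ofUnary]
    have := (I a).two_mul_n_lt_size_enc
    omega

theorem greedy (hI : PolyTime e fun a => (I a).enc) :
    PolyTime e fun a => Data.list Data.ofUnary (I a).greedy := by
  have one := PolyBounded.const e 1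
  have source := refl (Data.prod e (Data.list Data.ofUnary))
  refine iterate (eb := Data.list Data.ofUnary) (init := fun _ => [0])
    (step := fun a A => (I a).farthest A :: A) (ofUnary_pred (instance_k hI))
    (const (Data.list Data.ofUnary [0])) ((farthest hI.comp_fst source.snd).pair source.snd)
    (one.add ((instance_k hI).polyBounded_ofUnary.mul (one.add hI.polyBounded_size)))
    fun a i hi => ?_
  have elem_size : ∀ d ∈ ((I a).greedyList i).map Data.ofUnary, d.size ≤ (I a).enc.size := by
    simp only [List.mem_map, forall_exists_index, and_imp, forall_apply_eq_imp_iff₂,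
      Data.size_ofUnary]
    intro x hx
    have := (I a).lt_of_mem_greedyList hx
    have := (I a).two_mul_n_lt_size_enc
    omega
  refine (Data.size_ofList_le elem_size).trans ?_
  rw [List.length_map, KMedianInstance.length_greedyList]
  gcongr
  have := (I a).one_le_k
  omega

theorem radius (hI : PolyTime e fun a => (I a).enc) :
    PolyTime e fun a => .ofBinary (I a).radius :=
  numTo hI (greedy hI) (farthest hI (greedy hI))

theorem cap (hI : PolyTime e fun a => (I a).enc) : PolyTime e fun a => .ofBinary (I a).cap := by
  have one := PolyBounded.const e 1
  have two := PolyBounded.const e 2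
  have n_bound := (instance_n hI).polyBounded_ofUnary
  have max_one_radius : PolyTime e fun a => .ofBinary (max 1 (I a).radius) :=
    (cond (decide_ofBinary_pos (radius hI)) (radius hI) (const (.ofBinary 1))).of_eq fun a => by
      rcases Nat.eq_zero_or_pos (I a).radius with h | h
      · simp [h]
      · simp [h, max_eq_right (Nat.succ_le_of_lt h)]
  have source := refl (Data.prod e (Data.prod Data.ofUnary Data.ofBinary))
  refine (iterate (eb := Data.prod Data.ofUnary Data.ofBinary)
    (init := fun a => (1, max 1 (I a).radius))
    (step := fun a => KMedianInstance.doubleStep (I a).n)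
    (instance_n hI) ((const (.ofUnary 1)).pair max_one_radius)
    ((cond (decide_lt source.snd.fst (instance_n hI.comp_fst))
      ((ofUnary_mul (const (.ofUnary 2)) source.snd.fst).pair (ofBinary_two_mul source.snd.snd))
      source.snd).of_eq fun x => ?_)
    ((one.add (one.add (two.mul (two.mul n_bound)))).add
      (max_one_radius.polyBounded_size.add (two.mul n_bound))) fun a i hi => ?_).snd.of_eq
    fun a => ?_
  · simp only [decide_eq_true_eq, KMedianInstance.doubleStep, apply_ite (Data.prod _ _)]
    rfl
  · rw [KMedianInstance.iterate_doubleStep]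
    have factor_le := (Nat.pow_le_pow_right two_pos (min_le_right i _)).trans
      (KMedianInstance.two_pow_clog_le (I a).n_pos)
    have := Data.size_ofBinary_mul_two_pow_le (max 1 (I a).radius) (min i (Nat.clog 2 (I a).n))
    simp only [Data.size, Data.size_ofUnary]
    omega
  · have clog_le : Nat.clog 2 (I a).n ≤ (I a).n :=
      Nat.clog_le_of_le_pow (I a).n.lt_two_pow_self.le
    rw [KMedianInstance.iterate_doubleStep, min_eq_right clog_le]
    rfl

theorem capped (hI : PolyTime e fun a => (I a).enc) :
    PolyTime e fun a => (I a).capped.encode (I a).k := by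
  have source := refl (Data.prod (Data.prod e Data.ofUnary) Data.ofUnary)
  have row : PolyTime (Data.prod e Data.ofUnary) fun x => Data.list Data.ofBinary
      ((List.range (I x.1).n).map fun y => min ((I x.1).num x.2 y) (I x.1).cap) :=
    map (list_range (instance_n hI.comp_fst)) (ofBinary_min
      (num hI.comp_fst.comp_fst source.fst.snd source.snd) (cap hI.comp_fst.comp_fst))
  have matrix := map (eb := Data.list Data.ofBinary)
    (v := fun a x => (List.range (I a).n).map fun y => min ((I a).num x y) (I a).cap)
    (list_range (instance_n hI)) row
  refine ((instance_n hI).pair ((instance_k hI).pair ((cap hI).pair (matrix.pair nil)))).of_eq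
    fun a => ?_
  have matrix_eq : (I a).capped.numMatrix = (List.range (I a).n).map fun x =>
      (List.range (I a).n).map fun y => min ((I a).num x y) (I a).cap := by
    simp only [RationalMetric.numMatrix, KMedianInstance.capped, List.ofFn_eq_map,
      ← List.map_coe_finRange_eq_range, List.map_map, Function.comp_def, KMedianInstance.num_coe]
  rw [RationalMetric.encode_eq, matrix_eq]
  rfl

theorem select (hI : PolyTime e fun a => (I a).enc) {C : α → List ℕ}
    (hC : PolyTime e fun a => Data.list Data.ofUnary (C a)) :
    PolyTime e fun a => Data.list Data.ofUnary ((I a).select (C a)) := by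
  have source := refl (Data.prod (Data.prod e Data.ofUnary) Data.ofUnary)
  have all_far := all (c := fun (x : α × ℕ) b => decide ((I x.1).cap ≤ (I x.1).num x.2 b))
    (hC.comp_fst (f := Data.ofUnary)) (decide_le_ofBinary (cap hI.comp_fst.comp_fst)
      (num hI.comp_fst.comp_fst source.fst.snd source.snd))
  refine (cond (any (c := fun a x => (C a).all fun b => decide ((I a).cap ≤ (I a).num x b))
    (list_range (instance_n hI)) all_far) (greedy hI) hC).of_eq fun a => ?_
  simp only [KMedianInstance.select, List.any_eq_true, List.all_eq_true, decide_eq_true_eq,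
    apply_ite (Data.list Data.ofUnary)]

theorem fill {n k : α → ℕ} {C : α → List ℕ} (hn : PolyTime e fun a => .ofUnary (n a))
    (hk : PolyTime e fun a => .ofUnary (k a))
    (hC : PolyTime e fun a => Data.list Data.ofUnary (C a)) :
    PolyTime e fun a => Data.list Data.ofUnary (KServer.fill (n a) (k a) (C a)) := by
  have source := refl (Data.prod (Data.prod e Data.ofUnary) Data.ofUnary)
  have decide_mem : PolyTime (Data.prod e Data.ofUnary) fun x => .ofBool (decide (x.2 ∈ C x.1)) :=
    (any (c := fun (x : α × ℕ) b => decide (x.2 = b)) (hC.comp_fst (f := Data.ofUnary))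
      (decide_eq source.fst.snd source.snd)).of_eq fun x => by
        congr 1
        rw [Bool.eq_iff_iff]
        simp
  have decide_notMem : PolyTime (Data.prod e Data.ofUnary) fun x =>
      .ofBool (decide (x.2 ∉ C x.1)) := (not decide_mem).of_eq fun x => by rw [decide_not]
  exact take (append (filter (c := fun a x => decide (x ∈ C a)) (list_range hn) decide_mem)
    (filter (c := fun a x => decide (x ∉ C a)) (list_range hn) decide_notMem)) hk

end PolyTime

/-! ### Costs of configurations -/

section Configurations

variable {n k : ℕ}

namespace RationalMetric

variable (M : RationalMetric n)

theorem dist_nonneg (x y : Fin n) : 0 ≤ M.dist x y :=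
  div_nonneg (Nat.cast_nonneg _) (Nat.cast_nonneg _)

theorem dist_self (x : Fin n) : M.dist x x = 0 := by
  rw [dist, M.num_self, Nat.cast_zero, zero_div]

theorem dist_comm (x y : Fin n) : M.dist x y = M.dist y x := by
  rw [dist, M.symm, ← dist]

theorem dist_triangle (x y z : Fin n) : M.dist x z ≤ M.dist x y + M.dist y z := by
  simp only [dist, ← add_div]
  gcongr
  exact_mod_cast M.triangle x y z

end RationalMetric

variable (M : RationalMetric n)

/-- The distance of a point to a configuration. -/
noncomputable def configDist (x : Fin n) (C : Fin k → Fin n) : ℝ := ⨅ i, M.dist x (C i)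

/-- The sum of the distances of all points to a configuration. -/
noncomputable def configVal (C : Fin k → Fin n) : ℝ := ∑ x, configDist M x C

theorem configDist_nonneg (x : Fin n) (C : Fin k → Fin n) : 0 ≤ configDist M x C :=
  Real.iInf_nonneg fun _ => M.dist_nonneg _ _

theorem configVal_nonneg (C : Fin k → Fin n) : 0 ≤ configVal M C :=
  Finset.sum_nonneg fun _ _ => configDist_nonneg M _ _

theorem configDist_le_dist (x : Fin n) (C : Fin k → Fin n) (i : Fin k) :
    configDist M x C ≤ M.dist x (C i) :=
  ciInf_le (Set.finite_range _).bddBelow i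

theorem configDist_le_configVal (x : Fin n) (C : Fin k → Fin n) :
    configDist M x C ≤ configVal M C :=
  Finset.single_le_sum (f := fun x => configDist M x C) (fun _ _ => configDist_nonneg M _ _)
    (Finset.mem_univ x)

theorem exists_configDist_eq_dist [NeZero k] (x : Fin n) (C : Fin k → Fin n) :
    ∃ i, configDist M x C = M.dist x (C i) := by
  obtain ⟨i, hi⟩ := exists_eq_ciInf_of_finite (f := fun i => M.dist x (C i))
  exact ⟨i, hi.symm⟩

theorem serverLoss_eq (x : Fin n) (C : Fin k → Fin n) :
    serverLoss M x C = 2 * configDist M x C := by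
  rw [serverLoss]
  split_ifs with h
  · obtain ⟨i, rfl⟩ := h
    have := configDist_nonneg M (C i) C
    have := configDist_le_dist M (C i) C i
    rw [M.dist_self] at this
    linarith
  · simp only [configDist, M.dist_comm x]

theorem configDist_le_serverLoss_add_matchDist [NeZero k] (x : Fin n) (C C' : Fin k → Fin n) :
    configDist M x C' ≤ serverLoss M x C + matchDist M C C' := by
  obtain ⟨i, hi⟩ := exists_configDist_eq_dist M x C
  obtain ⟨σ, hσ⟩ := exists_eq_ciInf_of_finite
    (f := fun σ : Equiv.Perm (Fin k) => ∑ i, M.dist (C i) (C' (σ i)))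
  have move_le : M.dist (C i) (C' (σ i)) ≤ matchDist M C C' := by
    rw [matchDist, ← hσ]
    exact Finset.single_le_sum (f := fun i => M.dist (C i) (C' (σ i)))
      (fun _ _ => M.dist_nonneg _ _) (Finset.mem_univ i)
  have := M.dist_nonneg x (C i)
  calc configDist M x C' ≤ M.dist x (C' (σ i)) := configDist_le_dist M x C' _
    _ ≤ M.dist x (C i) + M.dist (C i) (C' (σ i)) := M.dist_triangle ..
    _ ≤ serverLoss M x C + matchDist M C C' := by rw [serverLoss_eq, hi]; linarith

-- The move to `C (t + 1)` and the loss there pay for the distance of `x (t + 1)` to `C t`, the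
-- configuration chosen before that request is known.
theorem sum_configDist_le_serverCost [NeZero k] (S : ℕ) (x : ℕ → Fin n) (C : ℕ → Fin k → Fin n) :
    ∑ t ∈ Finset.range S, configDist M (x (t + 1)) (C t) ≤ serverCost M (S + 1) x C := by
  have first_loss_nonneg : 0 ≤ serverLoss M (x 0) (C 0) := by
    rw [serverLoss_eq]
    exact mul_nonneg zero_le_two (configDist_nonneg M _ _)
  rw [serverCost, Finset.sum_range_succ', Finset.sum_Ico_eq_sum_range, Nat.add_sub_cancel,
    add_right_comm, ← Finset.sum_add_distrib]
  refine le_add_of_le_of_nonneg (Finset.sum_le_sum fun t _ => ?_) first_loss_nonneg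
  rw [Nat.add_sub_cancel_left, add_comm 1 t]
  exact configDist_le_serverLoss_add_matchDist M _ _ _

theorem bestStaticCost_le (T : ℕ) (x : ℕ → Fin n) (C : Fin k → Fin n) :
    bestStaticCost M k T x ≤ ∑ t ∈ Finset.range T, 2 * configDist M (x t) C := by
  refine (ciInf_le (Set.finite_range _).bddBelow C).trans_eq ?_
  simp only [serverLoss_eq]

theorem medianVal_le_sum {A : Finset (Fin n)} {f : Fin n → ℝ}
    (h : ∀ x, ∃ a ∈ A, M.dist x a ≤ f x) : medianVal M A ≤ ∑ x, f x := by
  refine Finset.sum_le_sum fun x _ => ?_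
  obtain ⟨a, ha, hle⟩ := h x
  exact (ciInf_le (Set.finite_range fun a : A => M.dist x a).bddBelow ⟨a, ha⟩).trans hle

theorem medianVal_univ : medianVal M Finset.univ = 0 := by
  refine le_antisymm ?_ (Finset.sum_nonneg fun x _ => Real.iInf_nonneg fun _ => M.dist_nonneg _ _)
  simpa using medianVal_le_sum M (f := 0)
    fun x => ⟨x, Finset.mem_univ x, (M.dist_self x).le⟩

end Configurations

/-! ### Separation of the greedy centres -/

namespace KMedianInstance

variable (I : KMedianInstance)

instance : NeZero I.k := ⟨(Nat.succ_le_iff.1 I.one_le_k).ne'⟩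

theorem pairwise_greedyList_succ (i : ℕ) : (I.greedyList (i + 1)).Pairwise fun a b =>
    I.numTo (I.greedyList i) (I.farthest (I.greedyList i)) ≤ I.num a b := by
  induction i with
  | zero =>
    rw [greedyList_succ, List.pairwise_cons]
    exact ⟨fun b hb => I.numTo_le (List.mem_cons_of_mem _ hb) _, List.pairwise_singleton _ _⟩
  | succ i ih =>
    have numTo_le_numTo (x : ℕ) :
        I.numTo (I.greedyList (i + 1)) x ≤ I.numTo (I.greedyList i) x := by
      rw [greedyList_succ, numTo, List.foldr_cons]
      exact min_le_left _ _
    rw [greedyList_succ _ (i + 1), List.pairwise_cons]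
    refine ⟨fun b hb => I.numTo_le (List.mem_cons_of_mem _ hb) _, ih.imp fun {a b} hab => ?_⟩
    exact (numTo_le_numTo _).trans ((I.numTo_le_numTo_farthest _ (I.farthest_lt _)).trans hab)

theorem exists_separated_points : ∃ y : Fin (I.k + 1) → Fin I.n,
    ∀ i j, i < j → I.radius ≤ I.metric.num (y i) (y j) := by
  have succ_pred := Nat.sub_add_cancel I.one_le_k
  have pairwise := I.pairwise_greedyList_succ (I.k - 1)
  rw [succ_pred] at pairwise
  have length_eq := I.length_greedyList I.k
  refine ⟨fun i => ⟨(I.greedyList I.k)[i], I.lt_of_mem_greedyList (List.getElem_mem _)⟩,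
    fun i j hij => ?_⟩
  rw [← num_coe]
  exact List.pairwise_iff_getElem.1 pairwise i j (by omega) (by omega) hij

theorem exists_radius_le_two_mul_num (C : Fin I.k → Fin I.n) :
    ∃ x, ∀ i, I.radius ≤ 2 * I.metric.num x (C i) := by
  by_contra! h
  choose nearest hnearest using h
  obtain ⟨y, hy⟩ := I.exists_separated_points
  obtain ⟨i, j, hij, heq⟩ := Fintype.exists_ne_map_eq_of_card_lt (fun i => nearest (y i)) (by simp)
  wlog hlt : i < j generalizing i j
  · exact this j i hij.symm heq.symm (lt_of_le_of_ne (not_lt.1 hlt) hij.symm)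
  have separated := hy i j hlt
  have triangle := I.metric.triangle (y i) (C (nearest (y i))) (y j)
  have near_i := hnearest (y i)
  have near_j := hnearest (y j)
  rw [I.metric.symm (C _)] at triangle
  rw [← show nearest (y i) = nearest (y j) from heq] at near_j
  omega

theorem exists_mem_greedy_num_le_radius (x : Fin I.n) :
    ∃ a : Fin I.n, ↑a ∈ I.greedy ∧ I.metric.num x a ≤ I.radius := by
  obtain ⟨a, ha, h⟩ := I.exists_numTo_eq I.greedy x
  have ha : a ∈ I.greedy := by
    rcases List.mem_cons.1 ha with rfl | ha
    exacts [I.zero_mem_greedyList _, ha]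
  refine ⟨⟨a, I.lt_of_mem_greedyList ha⟩, ha, ?_⟩
  rw [← num_coe, ← h]
  exact I.numTo_le_numTo_farthest _ x.2

theorem k_eq_n_of_radius_eq_zero (h : I.radius = 0) : I.k = I.n := by
  have range_subset : List.range I.n ⊆ I.greedy := fun x hx => by
    obtain ⟨a, ha, hle⟩ := I.exists_mem_greedy_num_le_radius ⟨x, List.mem_range.1 hx⟩
    rw [h, Nat.le_zero] at hle
    rwa [← I.metric.eq_of_num_eq_zero _ _ hle] at ha
  refine le_antisymm I.k_le_n ?_
  have := (List.nodup_range.subperm range_subset).length_le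
  rwa [List.length_range, I.length_greedy] at this

/-! ### The value of centres obtained from a configuration -/

/-- The unit of length of the truncated metric. -/
noncomputable def unit : ℝ := I.cap / I.metric.den

theorem unit_pos : 0 < I.unit :=
  div_pos (by exact_mod_cast I.cap_pos) (by exact_mod_cast I.metric.den_pos)

theorem unit_mul_capped_dist (x y : Fin I.n) :
    I.unit * I.capped.dist x y = min (I.metric.dist x y) I.unit := by
  have cap_ne : (I.cap : ℝ) ≠ 0 := by exact_mod_cast I.cap_pos.ne'
  rw [unit, RationalMetric.dist, RationalMetric.dist, min_div_div_right (Nat.cast_nonneg _)]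
  simp only [capped, Nat.cast_min]
  field_simp

theorem dist_lt_unit_iff (x y : Fin I.n) : I.metric.dist x y < I.unit ↔ I.num x y < I.cap := by
  rw [unit, RationalMetric.dist, div_lt_div_iff_of_pos_right (by exact_mod_cast I.metric.den_pos),
    Nat.cast_lt, num_coe]

/-- The set of points in a list. -/
def pointsOf (n : ℕ) (l : List ℕ) : Finset (Fin n) := Finset.univ.filter fun x => (x : ℕ) ∈ l

/-- The `k` centres obtained from a configuration. -/
def centresOf (C : Fin I.k → Fin I.n) : List ℕ :=
  fill I.n I.k (I.select (List.ofFn fun i => (C i : ℕ)))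

theorem medianVal_greedy_le :
    medianVal I.metric (pointsOf I.n (fill I.n I.k I.greedy)) ≤ I.unit := by
  have greedy_subset := subset_fill I.length_greedy.le fun x => I.lt_of_mem_greedyList (x := x)
  have val_le := medianVal_le_sum I.metric (A := pointsOf I.n (fill I.n I.k I.greedy))
    (f := fun _ => I.radius / I.metric.den) fun x => by
      obtain ⟨a, ha, hle⟩ := I.exists_mem_greedy_num_le_radius x
      refine ⟨a, by simpa [pointsOf] using greedy_subset ha, ?_⟩
      rw [RationalMetric.dist]
      gcongr
  refine val_le.trans ?_
  rw [Finset.sum_const, Finset.card_univ, Fintype.card_fin, nsmul_eq_mul, ← mul_div_assoc, unit]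
  gcongr
  exact_mod_cast I.n_mul_radius_le_cap

theorem one_le_configVal_capped_of_unit_le {C : Fin I.k → Fin I.n} {x : Fin I.n}
    (h : ∀ i, I.unit ≤ I.metric.dist x (C i)) : 1 ≤ configVal I.capped C := by
  obtain ⟨i, hi⟩ := exists_configDist_eq_dist I.capped x C
  have scaled := I.unit_mul_capped_dist x (C i)
  rw [min_eq_right (h i)] at scaled
  refine le_trans ?_ (configDist_le_configVal I.capped x C)
  rw [hi, mul_right_eq_self₀.1 scaled |>.resolve_right I.unit_pos.ne']

theorem medianVal_centresOf_le (C : Fin I.k → Fin I.n) :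
    medianVal I.metric (pointsOf I.n (I.centresOf C)) ≤ I.unit * configVal I.capped C := by
  rw [centresOf, select]
  split_ifs with h
  · obtain ⟨x, hx, hfar⟩ := h
    have far (i : Fin I.k) : I.unit ≤ I.metric.dist ⟨x, List.mem_range.1 hx⟩ (C i) := by
      rw [← not_lt, dist_lt_unit_iff, not_lt]
      exact hfar _ (by simp)
    exact I.medianVal_greedy_le.trans
      (le_mul_of_one_le_right I.unit_pos.le (I.one_le_configVal_capped_of_unit_le far))
  · have subset : List.ofFn (fun i => (C i : ℕ)) ⊆ _ :=
      subset_fill (by simp) (n := I.n) (k := I.k) (by simp)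
    rw [configVal, Finset.mul_sum]
    refine medianVal_le_sum I.metric fun x => ?_
    obtain ⟨i, hi⟩ := exists_configDist_eq_dist I.capped x C
    have near : ∃ j, I.metric.dist x (C j) < I.unit := by
      simp only [dist_lt_unit_iff]
      by_contra! hfar
      exact h ⟨x, by simp, by simpa using hfar⟩
    obtain ⟨j, hj⟩ := near
    have scaled_le := mul_le_mul_of_nonneg_left (configDist_le_dist I.capped x C j) I.unit_pos.le
    rw [hi, unit_mul_capped_dist, unit_mul_capped_dist, min_eq_left hj.le] at scaled_le
    refine ⟨C i, by simpa [pointsOf] using subset (by simp), ?_⟩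
    rw [hi, unit_mul_capped_dist, min_eq_left]
    exact (min_lt_iff.1 (scaled_le.trans_lt hj)).resolve_right (lt_irrefl _) |>.le

theorem unit_mul_configVal_capped_le {C : Fin I.k → Fin I.n} {A : Finset (Fin I.n)}
    (hA : A.Nonempty) (hsub : ∀ a ∈ A, a ∈ Set.range C) :
    I.unit * configVal I.capped C ≤ medianVal I.metric A := by
  have : Nonempty A := hA.to_subtype
  rw [configVal, Finset.mul_sum]
  refine Finset.sum_le_sum fun x _ => le_ciInf fun a => ?_
  obtain ⟨i, hi⟩ := hsub a a.2
  calc I.unit * configDist I.capped x C ≤ I.unit * I.capped.dist x (C i) :=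
        mul_le_mul_of_nonneg_left (configDist_le_dist _ _ _ _) I.unit_pos.le
    _ ≤ I.metric.dist x a := by rw [unit_mul_capped_dist, hi]; exact min_le_left _ _

theorem one_le_four_mul_n_mul_configVal_capped (h : 0 < I.radius) (C : Fin I.k → Fin I.n) :
    1 ≤ 4 * I.n * configVal I.capped C := by
  have cap_pos : (0 : ℝ) < I.cap := by exact_mod_cast I.cap_pos
  obtain ⟨x, hx⟩ := I.exists_radius_le_two_mul_num C
  obtain ⟨i, hi⟩ := exists_configDist_eq_dist I.capped x C
  have cap_le : I.cap ≤ 4 * I.n * I.capped.num x (C i) := by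
    have := I.n_pos
    have := I.cap_le h
    have := hx i
    rcases min_choice (I.metric.num x (C i)) I.cap with hmin | hmin <;>
      simp only [capped, hmin] <;> nlinarith
  calc (1 : ℝ) ≤ 4 * I.n * I.capped.num x (C i) / I.cap := by
        rw [one_le_div cap_pos]
        exact_mod_cast cap_le
    _ = 4 * I.n * configDist I.capped x C := by rw [hi, mul_div_assoc]; rfl
    _ ≤ 4 * I.n * configVal I.capped C := by gcongr; exact configDist_le_configVal _ _ _

end KMedianInstance

/-! ### Averages over strings of random bits -/

section Averages

/-- The average of a function of bit strings over all strings of length `m`. Lists, unlike functions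
on `Fin m`, can be cut into independent pieces without casts. -/
noncomputable def avg (m : ℕ) (g : List Bool → ℝ) : ℝ :=
  expect fun r : Fin m → Bool => g (List.ofFn r)

variable {m : ℕ} {g h : List Bool → ℝ}

theorem expect_eq_avg (g : (Fin m → Bool) → ℝ) :
    expect g = avg m fun l => g fun i => l.getD i false := by
  rw [avg]
  congr! 2 with r
  congr 1
  funext i
  simp

theorem avg_zero (g : List Bool → ℝ) : avg 0 g = g [] := by simp [avg, expect]

theorem avg_succ (m : ℕ) (g : List Bool → ℝ) :
    avg (m + 1) g = (avg m (fun l => g (false :: l)) + avg m fun l => g (true :: l)) / 2 := by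
  simp only [avg, expect]
  rw [← (Fin.consEquiv fun _ : Fin (m + 1) => Bool).sum_comp, Fintype.sum_prod_type]
  simp only [Fin.consEquiv_apply, List.ofFn_succ, Fin.cons_zero, Fin.cons_succ, Fintype.sum_bool]
  rw [pow_succ]
  field_simp
  ring

theorem avg_add_length (a b : ℕ) (g : List Bool → ℝ) :
    avg (a + b) g = avg a fun u => avg b fun v => g (u ++ v) := by
  induction a generalizing g with
  | zero => simp [avg_zero]
  | succ a ih => simp only [Nat.add_right_comm a, avg_succ, ih, List.cons_append]

theorem avg_mono (hgh : ∀ l, l.length = m → g l ≤ h l) : avg m g ≤ avg m h :=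
  div_le_div_of_nonneg_right (Finset.sum_le_sum fun r _ => hgh _ (List.length_ofFn ..))
    (by positivity)

theorem avg_congr (hgh : ∀ l, l.length = m → g l = h l) : avg m g = avg m h :=
  le_antisymm (avg_mono fun l hl => (hgh l hl).le) (avg_mono fun l hl => (hgh l hl).ge)

theorem avg_const (m : ℕ) (x : ℝ) : (avg m fun _ => x) = x := by simp [avg, expect]

theorem avg_add (m : ℕ) (g h : List Bool → ℝ) :
    (avg m fun l => g l + h l) = avg m g + avg m h := by
  simp only [avg, expect, Finset.sum_add_distrib, add_div]

theorem avg_mul (m : ℕ) (x : ℝ) (g : List Bool → ℝ) : (avg m fun l => x * g l) = x * avg m g := by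
  simp only [avg, expect, ← Finset.mul_sum, mul_div_assoc]

theorem avg_sum {ι : Type*} (s : Finset ι) (m : ℕ) (g : ι → List Bool → ℝ) :
    (avg m fun l => ∑ i ∈ s, g i l) = ∑ i ∈ s, avg m (g i) := by
  simp only [avg, expect, ← Finset.sum_div]
  rw [Finset.sum_comm]

theorem avg_nonneg (hg : ∀ l, 0 ≤ g l) : 0 ≤ avg m g :=
  div_nonneg (Finset.sum_nonneg fun _ _ => hg _) (by positivity)

theorem avg_take {a : ℕ} (ha : a ≤ m) (g : List Bool → ℝ) :
    (avg m fun l => g (l.take a)) = avg a g := by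
  obtain ⟨b, rfl⟩ := Nat.exists_eq_add_of_le ha
  rw [avg_add_length]
  exact avg_congr fun u hu => by simp only [List.take_left' hu, avg_const]

theorem avg_take_drop (a b d : ℕ) (g : List Bool → List Bool → List Bool → ℝ) :
    (avg (a + (b + d)) fun l => g (l.take a) ((l.drop a).take b) ((l.drop a).drop b)) =
      avg a fun u => avg b fun v => avg d fun w => g u v w := by
  rw [avg_add_length]
  refine avg_congr fun u hu => ?_
  rw [avg_add_length]
  refine avg_congr fun v hv => avg_congr fun w _ => ?_
  rw [List.take_left' hu, List.drop_left' hu, List.take_left' hv, List.drop_left' hv]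

end Averages

/-! ### The distribution of a sample -/

section Sample

variable {N L : ℕ} {δ : ℝ}

theorem sum_range_pow_succ (L : ℕ) (g : ℕ → ℝ) :
    ∑ j ∈ Finset.range (2 ^ (L + 1)), g j =
      ∑ j ∈ Finset.range (2 ^ L), g (2 * j) + ∑ j ∈ Finset.range (2 ^ L), g (2 * j + 1) := by
  rw [pow_succ']
  generalize 2 ^ L = K
  induction K with
  | zero => simp
  | succ K ih =>
    rw [Nat.mul_succ, Finset.sum_range_succ, Finset.sum_range_succ, ih, Finset.sum_range_succ,
      Finset.sum_range_succ]
    ring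

theorem avg_sample (N L : ℕ) (g : ℕ → ℝ) :
    (avg L fun l => g (sample N l)) = (∑ j ∈ Finset.range (2 ^ L), g (j % N)) / 2 ^ L := by
  induction L generalizing g with
  | zero => simp [avg_zero, sample]
  | succ L ih =>
    have sample_cons (b : Bool) (l : List Bool) :
        sample N (b :: l) = (b.toNat + 2 * sample N l) % N := rfl
    have digit_mod (b j : ℕ) : (b + 2 * (j % N)) % N = (2 * j + b) % N := by
      rw [add_comm, Nat.add_mod, Nat.mul_mod, Nat.mod_mod, ← Nat.mul_mod, ← Nat.add_mod]
    simp only [avg_succ, sample_cons]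
    rw [ih fun v => g ((false.toNat + 2 * v) % N), ih fun v => g ((true.toNat + 2 * v) % N),
      sum_range_pow_succ]
    simp only [digit_mod, Bool.toNat_false, Bool.toNat_true, Nat.add_zero]
    rw [← add_div, div_div, pow_succ]

theorem sum_range_mod (N P : ℕ) (g : ℕ → ℝ) :
    ∑ j ∈ Finset.range P, g (j % N) =
      (P / N : ℕ) * ∑ x ∈ Finset.range N, g x + ∑ x ∈ Finset.range (P % N), g x := by
  have block {r : ℕ} (q : ℕ) (hr : r ≤ N) :
      ∑ x ∈ Finset.range r, g ((q * N + x) % N) = ∑ x ∈ Finset.range r, g x :=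
    Finset.sum_congr rfl fun x hx => by
      rw [Nat.mul_add_mod', Nat.mod_eq_of_lt ((Finset.mem_range.1 hx).trans_le hr)]
  have blocks (q : ℕ) :
      ∑ j ∈ Finset.range (q * N), g (j % N) = q * ∑ x ∈ Finset.range N, g x := by
    induction q with
    | zero => simp
    | succ q ih =>
      rw [Nat.succ_mul, Finset.sum_range_add, ih, block q le_rfl]
      push_cast
      ring
  rcases Nat.eq_zero_or_pos N with rfl | hN
  · simp
  · conv_lhs => rw [← Nat.div_add_mod' P N]
    rw [Finset.sum_range_add, blocks, block _ (Nat.mod_lt P hN).le]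

theorem le_avg_sample (hN : 0 < N) (hδ : (N : ℝ) ≤ δ * 2 ^ L) {g : ℕ → ℝ} (hg : ∀ x, 0 ≤ g x) :
    (1 - δ) / N * ∑ x ∈ Finset.range N, g x ≤ avg L fun l => g (sample N l) := by
  have N_pos : (0 : ℝ) < N := by exact_mod_cast hN
  have quotient_ge : (1 - δ) / N * 2 ^ L ≤ (2 ^ L / N : ℕ) := by
    have := Nat.lt_div_mul_add (a := 2 ^ L) hN
    have : (2 : ℝ) ^ L < (2 ^ L / N : ℕ) * N + N := by exact_mod_cast this
    rw [div_mul_eq_mul_div, div_le_iff₀ N_pos]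
    linarith
  rw [avg_sample, sum_range_mod, le_div_iff₀ (by positivity), mul_right_comm]
  exact (mul_le_mul_of_nonneg_right quotient_ge (Finset.sum_nonneg fun x _ => hg x)).trans
    (le_add_of_nonneg_right (Finset.sum_nonneg fun x _ => hg x))

theorem avg_sample_le (hN : 0 < N) (hδ : (N : ℝ) ≤ δ * 2 ^ L) {g : ℕ → ℝ} (hg : ∀ x, 0 ≤ g x) :
    (avg L fun l => g (sample N l)) ≤ (1 + δ) / N * ∑ x ∈ Finset.range N, g x := by
  have N_pos : (0 : ℝ) < N := by exact_mod_cast hN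
  have quotient_le : ((2 ^ L / N : ℕ) : ℝ) + 1 ≤ (1 + δ) / N * 2 ^ L := by
    have : ((2 ^ L / N : ℕ) : ℝ) * N ≤ 2 ^ L := by exact_mod_cast Nat.div_mul_le_self _ _
    rw [div_mul_eq_mul_div, le_div_iff₀ N_pos]
    linarith
  have remainder_le : ∑ x ∈ Finset.range (2 ^ L % N), g x ≤ ∑ x ∈ Finset.range N, g x :=
    Finset.sum_le_sum_of_subset_of_nonneg (Finset.range_subset_range.2 (Nat.mod_lt _ hN).le)
      fun x _ _ => hg x
  have sum_nonneg : 0 ≤ ∑ x ∈ Finset.range N, g x := Finset.sum_nonneg fun x _ => hg x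
  rw [avg_sample, sum_range_mod, div_le_iff₀ (by positivity), mul_right_comm]
  refine le_trans ?_ (mul_le_mul_of_nonneg_right quotient_le sum_nonneg)
  linarith

theorem sum_range_ofNat (n : ℕ) [NeZero n] (g : Fin n → ℝ) :
    ∑ x ∈ Finset.range n, g (Fin.ofNat n x) = ∑ x, g x := by
  simp only [Finset.sum_range, Fin.ofNat_eq_cast, Fin.cast_val_eq_self]

end Sample

/-! ### The online algorithm on random requests -/

section RandomRequests

variable {n k : ℕ} (M : RationalMetric n) (σ : List Bool → List (Fin n) → Fin k → Fin n)
  {S K : ℕ} {R : ℝ}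

theorem sum_avg_configDist_le [NeZero k] {x : ℕ → Fin n}
    (hR : (avg K fun w => serverCost M (S + 1) x fun t => σ w ((List.range (t + 1)).map x)) ≤
      bestStaticCost M k (S + 1) x + R) (C : Fin k → Fin n) :
    ∑ t ∈ Finset.range S,
        (avg K fun w => configDist M (x (t + 1)) (σ w ((List.range (t + 1)).map x))) ≤
      ∑ t ∈ Finset.range (S + 1), 2 * configDist M (x t) C + R := by
  rw [← avg_sum]
  calc _ ≤ _ := avg_mono fun w _ => sum_configDist_le_serverCost M S x _
    _ ≤ bestStaticCost M k (S + 1) x + R := hR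
    _ ≤ _ := by gcongr; exact bestStaticCost_le M _ x C

variable [NeZero n] {L : ℕ} {δ : ℝ}

/-- The request in round `t` that is read off from the random bits `v`, with `L` bits for each
round. -/
def request (n L : ℕ) [NeZero n] (v : List Bool) (t : ℕ) : Fin n :=
  Fin.ofNat n (sample n ((v.drop (t * L)).take L))

/-- The first `t + 1` requests that are read off from the random bits `v`. -/
def requests (n L : ℕ) [NeZero n] (v : List Bool) (t : ℕ) : List (Fin n) :=
  (List.range (t + 1)).map (request n L v)

theorem request_take (v : List Bool) {s t : ℕ} (hst : s < t) :
    request n L (v.take (t * L)) s = request n L v s := by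
  have : L ≤ t * L - s * L := by
    rw [← Nat.sub_mul]
    exact Nat.le_mul_of_pos_left _ (Nat.sub_pos_of_lt hst)
  rw [request, List.drop_take, List.take_take, min_eq_left this, ← request]

theorem requests_take (v : List Bool) {s t : ℕ} (hst : s < t) :
    requests n L (v.take (t * L)) s = requests n L v s :=
  List.map_congr_left fun _ hr =>
    request_take v ((Nat.lt_succ_iff.1 (List.mem_range.1 hr)).trans_lt hst)

theorem avg_take_request {t T : ℕ} (htT : t < T) (g : List Bool → Fin n → ℝ) :
    (avg (T * L) fun v => g (v.take (t * L)) (request n L v t)) =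
      avg (t * L) fun u => avg L fun v => g u (Fin.ofNat n (sample n v)) := by
  have le_mul : t * L + L ≤ T * L := by
    rw [← Nat.succ_mul]
    exact Nat.mul_le_mul_right _ htT
  calc _ = avg (T * L) fun v => g ((v.take (t * L + L)).take (t * L))
            (request n L (v.take (t * L + L)) t) := avg_congr fun v _ => by
        rw [List.take_take, min_eq_left (Nat.le_add_right _ _), ← Nat.succ_mul,
          request_take v (Nat.lt_succ_self t)]
    _ = avg (t * L + L) fun v => g (v.take (t * L)) (request n L v t) :=
        avg_take le_mul fun v => g (v.take (t * L)) (request n L v t)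
    _ = _ := by
        rw [avg_add_length]
        refine avg_congr fun u hu => avg_congr fun v hv => ?_
        rw [List.take_left' hu, request, List.drop_left' hu, List.take_of_length_le hv.le]

theorem le_avg_request (hδ : (n : ℝ) ≤ δ * 2 ^ L) {t T : ℕ} (htT : t < T)
    {g : List Bool → Fin n → ℝ} (hg : ∀ v x, 0 ≤ g v x) :
    (1 - δ) / n * (avg (T * L) fun v => ∑ x, g (v.take (t * L)) x) ≤
      avg (T * L) fun v => g (v.take (t * L)) (request n L v t) := by
  rw [avg_take_request htT, avg_take (Nat.mul_le_mul_right L htT.le) fun v => ∑ x, g v x, ← avg_mul]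
  refine avg_mono fun u _ => ?_
  rw [← sum_range_ofNat]
  exact le_avg_sample (NeZero.pos n) hδ fun x => hg u _

theorem avg_request_le (hδ : (n : ℝ) ≤ δ * 2 ^ L) {t T : ℕ} (htT : t < T)
    {g : Fin n → ℝ} (hg : ∀ x, 0 ≤ g x) :
    (avg (T * L) fun v => g (request n L v t)) ≤ (1 + δ) / n * ∑ x, g x := by
  rw [avg_take_request htT fun _ => g, avg_const, ← sum_range_ofNat]
  exact avg_sample_le (NeZero.pos n) hδ fun x => hg _

theorem sum_avg_configDist_request_le (hδ : (n : ℝ) ≤ δ * 2 ^ L) (T : ℕ) (C : Fin k → Fin n) :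
    ∑ t ∈ Finset.range T, (avg (T * L) fun v => 2 * configDist M (request n L v t) C) ≤
      T * (2 * ((1 + δ) / n * configVal M C)) := by
  refine (Finset.sum_le_card_nsmul _ _ (2 * ((1 + δ) / n * configVal M C))
    fun t ht => ?_).trans_eq (by rw [Finset.card_range, nsmul_eq_mul])
  rw [avg_mul]
  gcongr
  exact avg_request_le hδ (Finset.mem_range.1 ht) fun x => configDist_nonneg M x C

theorem le_avg_configDist_request (hδ : (n : ℝ) ≤ δ * 2 ^ L) {t T : ℕ} (htT : t + 1 < T) :
    (1 - δ) / n * (avg (T * L) fun v => avg K fun w => configVal M (σ w (requests n L v t))) ≤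
      avg (T * L) fun v => avg K fun w =>
        configDist M (request n L v (t + 1)) (σ w (requests n L v t)) := by
  have := le_avg_request hδ htT
    (g := fun v x => avg K fun w => configDist M x (σ w (requests n L v t)))
    fun v x => avg_nonneg fun w => configDist_nonneg M x _
  simp only [requests_take _ (Nat.lt_succ_self t), ← avg_sum] at this
  exact this

variable [NeZero k]

theorem sum_avg_configVal_requests_le (hδ : (n : ℝ) ≤ δ * 2 ^ L)
    (hR : ∀ x : ℕ → Fin n,
      (avg K fun w => serverCost M (S + 1) x fun t => σ w ((List.range (t + 1)).map x)) ≤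
        bestStaticCost M k (S + 1) x + R) (C : Fin k → Fin n) :
    (1 - δ) / n * ∑ t ∈ Finset.range S, (avg ((S + 1) * L) fun v => avg K fun w =>
        configVal M (σ w (requests n L v t))) ≤
      (S + 1) * (2 * ((1 + δ) / n * configVal M C)) + R := by
  rw [Finset.mul_sum]
  calc _ ≤ ∑ t ∈ Finset.range S, avg ((S + 1) * L) fun v => avg K fun w =>
          configDist M (request n L v (t + 1)) (σ w (requests n L v t)) :=
        Finset.sum_le_sum fun t ht => le_avg_configDist_request M σ hδ
          (Nat.succ_lt_succ (Finset.mem_range.1 ht))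
    _ ≤ avg ((S + 1) * L) fun v =>
          ∑ t ∈ Finset.range (S + 1), 2 * configDist M (request n L v t) C + R := by
        rw [← avg_sum]
        exact avg_mono fun v _ => sum_avg_configDist_le M σ (hR (request n L v)) C
    _ ≤ (S + 1) * (2 * ((1 + δ) / n * configVal M C)) + R := by
        rw [avg_add, avg_const, avg_sum]
        gcongr
        exact_mod_cast sum_avg_configDist_request_le M hδ (S + 1) C

-- A uniformly random round turns the sum over the rounds into an expectation, so one configuration
-- suffices.
theorem avg_configVal_requests_sample_le (hδ : (n : ℝ) ≤ δ * 2 ^ L) (hδ1 : δ ≤ 1) (hS : 0 < S)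
    {a : ℕ} (ha : (S : ℝ) ≤ δ * 2 ^ a)
    (hR : ∀ x : ℕ → Fin n,
      (avg K fun w => serverCost M (S + 1) x fun t => σ w ((List.range (t + 1)).map x)) ≤
        bestStaticCost M k (S + 1) x + R) (C : Fin k → Fin n) :
    (1 - δ) * (avg a fun u => avg ((S + 1) * L) fun v => avg K fun w =>
        configVal M (σ w (requests n L v (sample S u)))) ≤
      (1 + δ) / S * ((S + 1) * (2 * ((1 + δ) * configVal M C)) + n * R) := by
  set Q : ℕ → ℝ := fun t => avg ((S + 1) * L) fun v => avg K fun w =>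
    configVal M (σ w (requests n L v t))
  have Q_nonneg (t : ℕ) : 0 ≤ Q t := avg_nonneg fun v => avg_nonneg fun w =>
    configVal_nonneg M _
  have n_pos : (0 : ℝ) < n := by exact_mod_cast NeZero.pos n
  have : (0 : ℝ) < S := by exact_mod_cast hS
  have δ_nonneg : 0 ≤ δ := nonneg_of_mul_nonneg_left (n_pos.le.trans hδ) (by positivity)
  have : 0 ≤ 1 - δ := sub_nonneg.2 hδ1
  calc _ ≤ (1 - δ) * ((1 + δ) / S * ∑ t ∈ Finset.range S, Q t) := by
        gcongr
        exact avg_sample_le hS ha Q_nonneg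
    _ = (1 + δ) / S * (n * ((1 - δ) / n * ∑ t ∈ Finset.range S, Q t)) := by field_simp
    _ ≤ (1 + δ) / S * (n * ((S + 1) * (2 * ((1 + δ) / n * configVal M C)) + R)) := by
        gcongr
        exact sum_avg_configVal_requests_le M σ hδ hR C
    _ = _ := by field_simp

end RandomRequests

/-! ### The approximation algorithm -/

theorem Data.list_ofBool_ofFn {m : ℕ} (r : Fin m → Bool) :
    Data.list Data.ofBool (List.ofFn r) = .ofBits r := by
  rw [Data.ofBits, Data.list, List.map_ofFn]
  rfl

theorem Data.size_ofBits_le {m : ℕ} (r : Fin m → Bool) : (Data.ofBits r).size ≤ 1 + 4 * m := by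
  have size_bit_le : ∀ d ∈ List.ofFn fun i => Data.ofBool (r i), d.size ≤ 3 := by
    simp only [List.forall_mem_ofFn_iff]
    intro i
    cases r i <;> simp [Data.ofBool, Data.size]
  have := Data.size_ofList_le size_bit_le
  rw [List.length_ofFn] at this
  rw [Data.ofBits]
  omega

namespace PolyTime

theorem ofPoints_requests {α : Type*} {e : α → Data} {n L t : α → ℕ} [∀ a, NeZero (n a)]
    {v : α → List Bool} (hn : PolyTime e fun a => .ofUnary (n a))
    (hL : PolyTime e fun a => .ofUnary (L a))
    (hv : PolyTime e fun a => Data.list Data.ofBool (v a))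
    (ht : PolyTime e fun a => .ofUnary (t a)) :
    PolyTime e fun a => .ofPoints (requests (n a) (L a) (v a) (t a)) := by
  have block := take (drop (hv.comp_fst (f := Data.ofUnary))
    (ofUnary_mul (refl (Data.prod e Data.ofUnary)).snd hL.comp_fst)) hL.comp_fst
  refine (map (eb := Data.ofUnary)
    (v := fun a s => KServer.sample (n a) (((v a).drop (s * L a)).take (L a)))
    (list_range (ofUnary_succ ht))
    (sample (fun x => NeZero.pos (n x.1)) hn.comp_fst block)).of_eq fun a => ?_
  rw [Data.ofPoints_eq, requests, List.map_map]
  refine congrArg _ (List.map_congr_left fun s _ => ?_)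
  exact Nat.mod_eq_of_lt (sample_lt (NeZero.pos _) _)

theorem ofBits_getD {α : Type*} {e : α → Data} {m : α → ℕ} {l : α → List Bool}
    (hm : PolyTime e fun a => .ofUnary (m a))
    (hl : PolyTime e fun a => Data.list Data.ofBool (l a)) :
    PolyTime e fun a => .ofBits fun i : Fin (m a) => (l a).getD i false := by
  refine (map (eb := Data.ofBool) (v := fun a i => (l a).getD i false) (list_range hm)
    (getD rfl hl.comp_fst (refl (Data.prod e Data.ofUnary)).snd)).of_eq fun a => ?_
  rw [← Data.list_ofBool_ofFn, List.ofFn_eq_map, ← List.map_coe_finRange_eq_range, List.map_map]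
  rfl

theorem ofPoints_config (A : KServerAlgorithm) {α : Type*} {e : α → Data} {n k T : α → ℕ}
    [∀ a, NeZero (n a)] {M : ∀ a, RationalMetric (n a)} {w : α → List Bool}
    {past : ∀ a, List (Fin (n a))} (hM : PolyTime e fun a => (M a).encode (k a))
    (hT : PolyTime e fun a => .ofUnary (T a)) (hpast : PolyTime e fun a => .ofPoints (past a))
    (hw : PolyTime e fun a => Data.list Data.ofBool (w a)) (dist_le : ∀ a, (M a).DistLeOne)
    (one_le_k : ∀ a, 1 ≤ k a) (k_le_n : ∀ a, k a ≤ n a) (past_ne : ∀ a, past a ≠ [])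
    (length_past_le : ∀ a, (past a).length ≤ T a) :
    PolyTime e fun a => .ofPoints (List.ofFn
      (A.config (M a) (k a) (T a) (fun i => (w a).getD i false) (past a))) := by
  have coins := ofUnary_eval (ofUnary_add (ofUnary_size hM) hT) A.coins
  have input : PolyTime e fun a => serverInput (M a) (k a) (T a) (past a)
      fun i : Fin (A.coins.eval ((M a).inputSize (k a) + T a)) => (w a).getD i false :=
    hM.pair (hT.pair (hpast.pair ((ofBits_getD coins hw).pair nil)))
  refine input.trans (of_outputs A.prog (((PolyBounded.size _).mono fun a => ?_).eval A.time)
    fun a => A.computes _ _ _ (dist_le a) (one_le_k a) (k_le_n a) _ _ (past_ne a)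
      (length_past_le a))
  simp only [serverInput, Data.ofList, Data.size, Data.size_ofUnary, RationalMetric.inputSize]
  omega

end PolyTime

namespace KMedianInstance

theorem exists_list_fin_map_val_eq {n : ℕ} {l : List ℕ} (hl : l.Nodup) (hlt : ∀ x ∈ l, x < n) :
    ∃ l' : List (Fin n), l'.Nodup ∧ l'.toFinset = pointsOf n l ∧ l'.map (↑) = l := by
  lift l to List (Fin n) using hlt
  refine ⟨l, hl.of_map, ?_, rfl⟩
  ext x
  simp [pointsOf, Fin.val_inj]

theorem card_pointsOf {n : ℕ} {l : List ℕ} (hl : l.Nodup) (hlt : ∀ x ∈ l, x < n) :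
    (pointsOf n l).card = l.length := by
  obtain ⟨l', hl', h, rfl⟩ := exists_list_fin_map_val_eq hl hlt
  rw [← h, List.toFinset_card_of_nodup hl', List.length_map]

section

variable (A : KServerAlgorithm) (p : Polynomial ℕ) (c : ℕ) (I : KMedianInstance)

/-- The number of rounds from which the algorithm for `k`-median picks one at random. -/
def rounds : ℕ := p.eval I.n + 1

/-- The configuration that the online algorithm `A`, with time horizon `I.rounds p + 1` and random
bits `w`, chooses on the truncated metric after the requests `past`. -/
def configuration (w : List Bool) (past : List (Fin I.n)) : Fin I.k → Fin I.n :=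
  A.config I.capped I.k (I.rounds p + 1) (fun i => w.getD i false) past

/-- The number of random bits used to choose the round; the slack `c` makes the choice uniform up to
a factor `1 ± 1 / 2 ^ c`. -/
def roundCoins : ℕ := I.rounds p + c

/-- The number of random bits used for each request, with the same slack `c`. -/
def requestCoins : ℕ := I.n + c

/-- The number of random bits used by the online algorithm. -/
def serverCoins : ℕ := A.coins.eval (I.capped.inputSize I.k + (I.rounds p + 1))

/-- The number of random bits used by the algorithm for `k`-median. -/
def coins : ℕ :=
  I.roundCoins p c + ((I.rounds p + 1) * I.requestCoins c + I.serverCoins A p)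

/-- The output of the algorithm for `k`-median with the random bits `l`, which are those for the
round, for the requests and for the online algorithm, in this order. -/
def centres (l : List Bool) : List ℕ :=
  I.centresOf (I.configuration A p
    ((l.drop (I.roundCoins p c)).drop ((I.rounds p + 1) * I.requestCoins c))
    (requests I.n (I.requestCoins c)
      ((l.drop (I.roundCoins p c)).take ((I.rounds p + 1) * I.requestCoins c))
      (sample (I.rounds p) (l.take (I.roundCoins p c)))))

theorem rounds_pos : 0 < I.rounds p := Nat.succ_pos _

theorem nodup_centresOf (C : Fin I.k → Fin I.n) : (I.centresOf C).Nodup := nodup_fill ..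

theorem length_centresOf (C : Fin I.k → Fin I.n) : (I.centresOf C).length = I.k :=
  length_fill I.k_le_n _

theorem lt_of_mem_centresOf {C : Fin I.k → Fin I.n} {x : ℕ} (hx : x ∈ I.centresOf C) : x < I.n :=
  lt_of_mem_fill hx

theorem avg_medianVal_centres_le :
    (avg (I.coins A p c) fun l => medianVal I.metric (pointsOf I.n (I.centres A p c l))) ≤
      I.unit * avg (I.roundCoins p c) fun u =>
        avg ((I.rounds p + 1) * I.requestCoins c) fun v => avg (I.serverCoins A p) fun w =>
          configVal I.capped (I.configuration A p w
            (requests I.n (I.requestCoins c) v (sample (I.rounds p) u))) := by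
  refine (avg_mono fun l _ => I.medianVal_centresOf_le _).trans_eq ?_
  rw [avg_mul, ← avg_take_drop, coins]

end

end KMedianInstance

namespace PolyTime

variable (A : KServerAlgorithm) (p : Polynomial ℕ) (c : ℕ) {α : Type*} {e : α → Data}
  {I : α → KMedianInstance}

theorem rounds (hI : PolyTime e fun a => (I a).enc) :
    PolyTime e fun a => .ofUnary ((I a).rounds p) :=
  ofUnary_succ (ofUnary_eval (instance_n hI) p)

theorem roundCoins (hI : PolyTime e fun a => (I a).enc) :
    PolyTime e fun a => .ofUnary ((I a).roundCoins p c) :=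
  ofUnary_add (rounds p hI) (const (.ofUnary c))

theorem requestCoins (hI : PolyTime e fun a => (I a).enc) :
    PolyTime e fun a => .ofUnary ((I a).requestCoins c) :=
  ofUnary_add (instance_n hI) (const (.ofUnary c))

theorem coins (hI : PolyTime e fun a => (I a).enc) :
    PolyTime e fun a => .ofUnary ((I a).coins A p c) :=
  ofUnary_add (roundCoins p c hI)
    (ofUnary_add (ofUnary_mul (ofUnary_succ (rounds p hI)) (requestCoins c hI))
      (ofUnary_eval (ofUnary_add (ofUnary_size (capped hI)) (ofUnary_succ (rounds p hI))) A.coins))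

theorem centres (hI : PolyTime e fun a => (I a).enc) {l : α → List Bool}
    (hl : PolyTime e fun a => Data.list Data.ofBool (l a)) :
    PolyTime e fun a => Data.list Data.ofUnary ((I a).centres A p c (l a)) := by
  have later_bits := drop hl (roundCoins p c hI)
  have request_bits := ofUnary_mul (ofUnary_succ (rounds p hI)) (requestCoins c hI)
  have past := ofPoints_requests (instance_n hI) (requestCoins c hI) (take later_bits request_bits)
    (sample (fun a => (I a).rounds_pos p) (rounds p hI) (take hl (roundCoins p c hI)))
  have config := ofPoints_config A (capped hI) (ofUnary_succ (rounds p hI)) past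
    (drop later_bits request_bits) (fun a => (I a).capped_distLeOne) (fun a => (I a).one_le_k)
    (fun a => (I a).k_le_n) (fun a => by simp [requests]) fun a => by
      rw [requests, List.length_map, List.length_range]
      exact Nat.succ_le_succ (sample_lt ((I a).rounds_pos p) _).le
  refine fill (instance_n hI) (instance_k hI) (select hI (config.of_eq fun a => ?_))
  rw [Data.ofPoints_eq, List.map_ofFn]
  rfl

end PolyTime

namespace KMedianInstance

/-- The input that an algorithm for `k`-median reads: an instance and a string of random bits. -/
def encWithBits (x : KMedianInstance × List Bool) : Data :=
  .ofList [x.1.enc, Data.list Data.ofBool x.2]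

variable {coins : KMedianInstance → ℕ} {centres : KMedianInstance → List Bool → List ℕ}

theorem exists_outputs_take_coins
    (hcoins : PolyTime enc fun I => .ofUnary (coins I))
    (hcentres : PolyTime encWithBits fun x => Data.list Data.ofUnary (centres x.1 x.2))
    (q : Polynomial ℕ) :
    ∃ (P : Prog) (t : Polynomial ℕ),
      ∀ (I : KMedianInstance) (r : Fin (q.eval (I.metric.inputSize I.k)) → Bool),
        P.Outputs (.ofList [I.metric.encode I.k, .ofBits r])
          (Data.list Data.ofUnary (centres I ((List.ofFn r).take (coins I))))
          (t.eval (I.metric.inputSize I.k)) := by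
  let Input := Σ I : KMedianInstance, Fin (q.eval (I.metric.inputSize I.k)) → Bool
  let input (x : Input) : Data := encWithBits (x.1, List.ofFn x.2)
  have inst : PolyTime input fun x => x.1.enc := (PolyTime.refl _).fst
  have bits : PolyTime input fun x => Data.list Data.ofBool ((List.ofFn x.2).take (coins x.1)) :=
    PolyTime.take (PolyTime.refl _).snd.fst (inst.trans (hcoins.comap Sigma.fst))
  obtain ⟨P, t, hP⟩ := (inst.pair (bits.pair .nil)).trans
    (hcentres.comap fun x : Input => (x.1, (List.ofFn x.2).take (coins x.1)))
  have size_input_le : PolyBounded (fun x : Input => x.1.enc) fun x => (input x).size := by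
    refine ((PolyBounded.size _).add ((PolyBounded.const _ 4).add
      ((PolyBounded.const _ 4).mul ((PolyBounded.size _).eval q)))).mono fun x => ?_
    have : (Data.ofBits x.2).size ≤ 1 + 4 * q.eval x.1.enc.size := Data.size_ofBits_le x.2
    simp only [input, encWithBits, Data.list_ofBool_ofFn, Data.ofList, Data.size]
    omega
  obtain ⟨t', ht'⟩ := size_input_le.eval t
  refine ⟨P, t', fun I r => ?_⟩
  obtain ⟨s, c, hs, hc, hout⟩ := hP ⟨I, r⟩
  rw [← Data.list_ofBool_ofFn]
  exact ⟨s, c, hs, hc.trans (ht' ⟨I, r⟩), hout⟩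

theorem exists_kMedianAlgorithm (hcoins : PolyTime enc fun I => .ofUnary (coins I))
    (hcentres : PolyTime encWithBits fun x => Data.list Data.ofUnary (centres x.1 x.2))
    (nodup : ∀ I l, (centres I l).Nodup) (length_eq : ∀ I l, (centres I l).length = I.k)
    (lt : ∀ I l, ∀ x ∈ centres I l, x < I.n) :
    ∃ B : KMedianAlgorithm, ∀ I : KMedianInstance,
      expect (fun r => medianVal I.metric (B.sol I.metric I.k r)) =
        avg (coins I) fun l => medianVal I.metric (pointsOf I.n (centres I l)) := by
  obtain ⟨q, coins_le⟩ := hcoins.polyBounded_ofUnary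
  obtain ⟨P, t, hP⟩ := exists_outputs_take_coins hcoins hcentres q
  refine ⟨⟨P, q, t, fun {n} M k r => if h : 1 ≤ k ∧ k ≤ n then
    pointsOf n (centres ⟨n, k, M, h.1, h.2⟩ ((List.ofFn r).take (coins ⟨n, k, M, h.1, h.2⟩)))
    else ∅, fun {n} M k hk hkn r => ?_⟩, fun I => ?_⟩
  · let I : KMedianInstance := ⟨n, k, M, hk, hkn⟩
    let l := (List.ofFn r).take (coins I)
    obtain ⟨l', nodup', toFinset_eq, map_eq⟩ :=
      exists_list_fin_map_val_eq (nodup I l) (lt I l)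
    rw [dif_pos ⟨hk, hkn⟩]
    refine ⟨(card_pointsOf (nodup I l) (lt I l)).trans (length_eq I l), l', nodup', toFinset_eq, ?_⟩
    rw [Data.ofPoints_eq, map_eq]
    exact hP I r
  · simp only [dif_pos (show 1 ≤ I.k ∧ I.k ≤ I.n from ⟨I.one_le_k, I.k_le_n⟩)]
    exact avg_take (coins_le I) fun l => medianVal I.metric (pointsOf I.n (centres I l))

end KMedianInstance

/-! ### The approximation ratio -/

theorem le_one_div_two_pow_mul {N c : ℕ} : (N : ℝ) ≤ 1 / 2 ^ c * 2 ^ (N + c) := by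
  rw [pow_add, one_div, mul_comm, mul_inv_cancel_right₀ (by positivity)]
  exact_mod_cast N.lt_two_pow_self.le

theorem le_rpow_of_pow_le {b T μ : ℝ} {m : ℕ} (hb : 1 ≤ b) (hμ : 0 ≤ μ) (hm : 1 ≤ m * μ)
    (hT : b ^ m ≤ T) : b ≤ T ^ μ :=
  calc b = b ^ (1 : ℝ) := (Real.rpow_one b).symm
    _ ≤ b ^ (m * μ) := Real.rpow_le_rpow_of_exponent_le hb hm
    _ = (b ^ m) ^ μ := by rw [Real.rpow_mul (by linarith), Real.rpow_natCast]
    _ ≤ T ^ μ := Real.rpow_le_rpow (by positivity) hT hμ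

theorem mul_mul_rpow_one_sub_le {n F T V δ μ : ℝ} (hn : 1 ≤ n) (hF : 0 ≤ F) (hT : 0 < T)
    (hV : 1 ≤ 4 * n * V) (hTμ : 8 * n ^ 2 * (F + 1) ≤ δ * T ^ μ) :
    n * (F * T ^ (1 - μ)) ≤ T * (δ * V / 2) := by
  have V_nonneg : 0 ≤ V := nonneg_of_mul_nonneg_right (by linarith) (show 0 < 4 * n by linarith)
  have n_mul_F_le : n * F ≤ T ^ μ * (δ * V / 2) := by
    calc n * F ≤ n * (F + 1) * 1 := by nlinarith
      _ ≤ n * (F + 1) * (4 * n * V) := by gcongr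
      _ = 8 * n ^ 2 * (F + 1) * (V / 2) := by ring
      _ ≤ δ * T ^ μ * (V / 2) := by gcongr
      _ = T ^ μ * (δ * V / 2) := by ring
  have : T ^ (1 - μ) * T ^ μ = T := by
    rw [← Real.rpow_add hT, sub_add_cancel, Real.rpow_one]
  calc n * (F * T ^ (1 - μ)) = T ^ (1 - μ) * (n * F) := by ring
    _ ≤ T ^ (1 - μ) * (T ^ μ * (δ * V / 2)) := by gcongr
    _ = T * (δ * V / 2) := by rw [← mul_assoc, this]

theorem le_two_add_mul_of_one_sub_mul_le {δ ε V E S Y : ℝ} (hδ : 0 < δ) (hδ2 : δ ≤ 1 / 2)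
    (hδε : 26 * δ ≤ ε) (hV : 0 ≤ V) (hS : 1 ≤ δ * S) (hY : Y ≤ (S + 1) * (δ * V / 2))
    (hE : (1 - δ) * E ≤ (1 + δ) / S * ((S + 1) * (2 * ((1 + δ) * V)) + Y)) :
    E ≤ (2 + ε) * V := by
  have S_pos : 0 < S := pos_of_mul_pos_right (by linarith) hδ.le
  have succ_div_le : (S + 1) / S ≤ 1 + δ := by
    rw [div_le_iff₀ S_pos]
    linarith
  have factor_le : (1 + δ) * (1 + δ) * (2 * (1 + δ) + δ / 2) ≤ (1 - δ) * (2 + ε) := by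
    have : (1 - δ) * (2 + 26 * δ) ≤ (1 - δ) * (2 + ε) := by gcongr; linarith
    have : 0 ≤ δ * (1 / 2 - δ) := mul_nonneg hδ.le (by linarith)
    have : 0 ≤ δ * δ * (1 / 2 - δ) := by rw [mul_assoc]; positivity
    nlinarith
  refine le_of_mul_le_mul_left ?_ (show 0 < 1 - δ by linarith)
  calc (1 - δ) * E ≤ (1 + δ) / S * ((S + 1) * (2 * ((1 + δ) * V)) + (S + 1) * (δ * V / 2)) :=
        hE.trans (by gcongr)
    _ = (1 + δ) * ((S + 1) / S) * (2 * (1 + δ) + δ / 2) * V := by field_simp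
    _ ≤ (1 + δ) * (1 + δ) * (2 * (1 + δ) + δ / 2) * V := by gcongr
    _ ≤ (1 - δ) * (2 + ε) * V := by gcongr
    _ = (1 - δ) * ((2 + ε) * V) := mul_assoc ..

/-- The polynomial that determines the number of rounds: `(8 * 2 ^ c * n ^ 2 * (f n + 1)) ^ m`
rounds make the regret `f n * T ^ (1 - μ)` negligible once `1 ≤ m * μ`. -/
noncomputable def horizonPoly (f : Polynomial ℕ) (c m : ℕ) : Polynomial ℕ :=
  (Polynomial.C (8 * 2 ^ c) * Polynomial.X ^ 2 * (f + 1)) ^ m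

namespace KMedianInstance

variable (I : KMedianInstance)

theorem exists_unit_mul_configVal_capped_le_medianOpt :
    ∃ C : Fin I.k → Fin I.n, I.unit * configVal I.capped C ≤ medianOpt I.metric I.k := by
  have : Nonempty {A : Finset (Fin I.n) // A.card = I.k} := by
    obtain ⟨A, -, hA⟩ := Finset.exists_subset_card_eq
      (s := (Finset.univ : Finset (Fin I.n))) (n := I.k) (by simpa using I.k_le_n)
    exact ⟨A, hA⟩
  obtain ⟨⟨A, hA⟩, hopt⟩ := exists_eq_ciInf_of_finite
    (f := fun A : {A : Finset (Fin I.n) // A.card = I.k} => medianVal I.metric A.1)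
  rw [medianOpt, ← hopt]
  exact ⟨A.orderEmbOfFin hA, I.unit_mul_configVal_capped_le
    (Finset.card_pos.1 (I.one_le_k.trans_eq hA.symm))
    fun a ha => by rwa [Finset.range_orderEmbOfFin]⟩

theorem one_le_eight_mul_sq_mul (f : Polynomial ℕ) :
    (1 : ℝ) ≤ 8 * I.n ^ 2 * ((f.eval I.n : ℕ) + 1) := by
  have := I.n_pos
  exact_mod_cast (show 0 < 8 * I.n ^ 2 * (f.eval I.n + 1) by positivity)

theorem cast_rounds_horizonPoly (f : Polynomial ℕ) (c m : ℕ) :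
    (I.rounds (horizonPoly f c m) : ℝ) =
      (2 ^ c * (8 * I.n ^ 2 * ((f.eval I.n : ℕ) + 1))) ^ m + 1 := by
  simp only [rounds, horizonPoly, Polynomial.eval_pow, Polynomial.eval_mul, Polynomial.eval_C,
    Polynomial.eval_X, Polynomial.eval_add, Polynomial.eval_one]
  push_cast
  ring

theorem one_le_mul_rounds_horizonPoly (f : Polynomial ℕ) (c : ℕ) {m : ℕ} (hm : m ≠ 0) :
    (1 : ℝ) ≤ 1 / 2 ^ c * I.rounds (horizonPoly f c m) := by
  have one_le_two_pow : (1 : ℝ) ≤ 2 ^ c := one_le_pow₀ one_le_two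
  have two_pow_le := le_mul_of_one_le_right (zero_le_one.trans one_le_two_pow)
    (I.one_le_eight_mul_sq_mul f)
  have := le_self_pow₀ (one_le_two_pow.trans two_pow_le) hm
  rw [one_div, inv_mul_eq_div, one_le_div (by positivity), cast_rounds_horizonPoly]
  linarith

theorem le_mul_rpow_rounds_horizonPoly (f : Polynomial ℕ) (c : ℕ) {m : ℕ} {μ : ℝ} (hμ : 0 ≤ μ)
    (hm : 1 ≤ m * μ) :
    8 * (I.n : ℝ) ^ 2 * ((f.eval I.n : ℕ) + 1) ≤
      1 / 2 ^ c * ((I.rounds (horizonPoly f c m) : ℝ) + 1) ^ μ := by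
  have one_le_two_pow : (1 : ℝ) ≤ 2 ^ c := one_le_pow₀ one_le_two
  rw [one_div, inv_mul_eq_div, le_div_iff₀' (by positivity), cast_rounds_horizonPoly]
  exact le_rpow_of_pow_le (one_le_mul_of_one_le_of_one_le one_le_two_pow
    (I.one_le_eight_mul_sq_mul f)) hμ hm (by linarith)

variable {A : KServerAlgorithm} {f : Polynomial ℕ} {μ ε : ℝ} {c m : ℕ}

theorem avg_configVal_configuration_le (hμ : 0 ≤ μ) (hδ : (1 : ℝ) / 2 ^ c ≤ 1 / 2)
    (hδε : 26 * ((1 : ℝ) / 2 ^ c) ≤ ε) (hm : 1 ≤ m * μ)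
    (hregret : A.HasRegret fun n T => ((f.eval n : ℕ) : ℝ) * (T : ℝ) ^ (1 - μ))
    (hI : 0 < I.radius) (C : Fin I.k → Fin I.n) :
    (avg (I.roundCoins (horizonPoly f c m) c) fun u =>
      avg ((I.rounds (horizonPoly f c m) + 1) * I.requestCoins c) fun v =>
        avg (I.serverCoins A (horizonPoly f c m)) fun w =>
          configVal I.capped (I.configuration A (horizonPoly f c m) w
            (requests I.n (I.requestCoins c) v (sample (I.rounds (horizonPoly f c m)) u)))) ≤
      (2 + ε) * configVal I.capped C := by
  have m_ne_zero : m ≠ 0 := by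
    rintro rfl
    norm_num at hm
  have regret (x : ℕ → Fin I.n) := hregret I.n I.capped I.k (I.rounds (horizonPoly f c m) + 1)
    I.capped_distLeOne I.one_le_k I.k_le_n (Nat.le_add_left _ _) x
  simp only [expect_eq_avg, Nat.cast_add_one] at regret
  exact le_two_add_mul_of_one_sub_mul_le (by positivity) hδ hδε (configVal_nonneg ..)
    (I.one_le_mul_rounds_horizonPoly f c m_ne_zero)
    (mul_mul_rpow_one_sub_le (by exact_mod_cast I.n_pos) (Nat.cast_nonneg _) (by positivity)
      (I.one_le_four_mul_n_mul_configVal_capped hI C) (I.le_mul_rpow_rounds_horizonPoly f c hμ hm))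
    (avg_configVal_requests_sample_le I.capped (I.configuration A (horizonPoly f c m))
      le_one_div_two_pow_mul (hδ.trans (by norm_num)) (I.rounds_pos _) le_one_div_two_pow_mul
      regret C)

theorem avg_medianVal_centres_le_medianOpt (hμ : 0 ≤ μ) (hδ : (1 : ℝ) / 2 ^ c ≤ 1 / 2)
    (hδε : 26 * ((1 : ℝ) / 2 ^ c) ≤ ε) (hm : 1 ≤ m * μ)
    (hregret : A.HasRegret fun n T => ((f.eval n : ℕ) : ℝ) * (T : ℝ) ^ (1 - μ)) :
    (avg (I.coins A (horizonPoly f c m) c) fun l =>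
      medianVal I.metric (pointsOf I.n (I.centres A (horizonPoly f c m) c l))) ≤
      (2 + ε) * medianOpt I.metric I.k := by
  have ε_pos : 0 < ε := lt_of_lt_of_le (by positivity) hδε
  obtain ⟨C, hC⟩ := I.exists_unit_mul_configVal_capped_le_medianOpt
  rcases Nat.eq_zero_or_pos I.radius with hI | hI
  · have opt_nonneg : 0 ≤ medianOpt I.metric I.k :=
      (mul_nonneg I.unit_pos.le (configVal_nonneg ..)).trans hC
    have eq_univ (l : List Bool) :
        pointsOf I.n (I.centres A (horizonPoly f c m) c l) = Finset.univ := by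
      rw [← Finset.card_eq_iff_eq_univ, centres, card_pointsOf (I.nodup_centresOf _)
        fun x hx => I.lt_of_mem_centresOf hx, I.length_centresOf,
        I.k_eq_n_of_radius_eq_zero hI, Fintype.card_fin]
    simp only [eq_univ, medianVal_univ, avg_const]
    positivity
  · calc _ ≤ _ := I.avg_medianVal_centres_le ..
      _ ≤ I.unit * ((2 + ε) * configVal I.capped C) :=
        mul_le_mul_of_nonneg_left
          (I.avg_configVal_configuration_le hμ hδ hδε hm hregret hI C) I.unit_pos.le
      _ = (2 + ε) * (I.unit * configVal I.capped C) := mul_left_comm ..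
      _ ≤ (2 + ε) * medianOpt I.metric I.k := by gcongr

end KMedianInstance

end KServer

theorem mainTheorem10 (A : KServer.KServerAlgorithm) (f : Polynomial ℕ) (μ : ℝ) (hμ : 0 < μ)
    (hregret : A.HasRegret fun n T => ((f.eval n : ℕ) : ℝ) * (T : ℝ) ^ (1 - μ)) :
    ∀ ε : ℝ, 0 < ε → ∃ B : KServer.KMedianAlgorithm, B.IsApprox (2 + ε) := by
  intro ε hε
  obtain ⟨c, hc⟩ := exists_pow_lt_of_lt_one (show (0 : ℝ) < min (1 / 2) (ε / 26) by positivity)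
    (show (1 / 2 : ℝ) < 1 by norm_num)
  rw [one_div_pow, lt_min_iff] at hc
  obtain ⟨m, hm⟩ := exists_nat_ge (1 / μ)
  rw [div_le_iff₀ hμ] at hm
  obtain ⟨B, hB⟩ := KServer.KMedianInstance.exists_kMedianAlgorithm
    (KServer.PolyTime.coins A (KServer.horizonPoly f c m) c (KServer.PolyTime.refl _))
    (KServer.PolyTime.centres A (KServer.horizonPoly f c m) c (KServer.PolyTime.refl _).fst
      (KServer.PolyTime.refl _).snd.fst)
    (fun I _ => I.nodup_centresOf _) (fun I _ => I.length_centresOf _)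
    fun I _ _ => I.lt_of_mem_centresOf
  refine ⟨B, fun n M k hk hkn => ?_⟩
  have approx := KServer.KMedianInstance.avg_medianVal_centres_le_medianOpt ⟨n, k, M, hk, hkn⟩
    hμ.le hc.1.le (show 26 * (1 / 2 ^ c) ≤ ε by linarith [hc.2]) hm hregret
  rwa [← hB] at approx
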